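/- Let $K\subset\mathbb{C}$ be a convex polygonal domain, i.e. the convex hull of finitely many points, with nonempty interior. For $0<q<\infty$ and a polynomial $p$ write $\|p\|_{L^q(\partial K)}:=\left(\int_{\partial K}|p(z)|^q\,|dz|\right)^{1/q}$, where $|dz|$ is arc length on the boundary $\partial K$. Then there is an $n_0=n_0(K)\in\mathbb{N}$ such that for every $0<q<\infty$ there is a constant $c_K=c_K(q)>0$, depending only on $K$ and $q$, with $$\|p'\|_{L^q(\partial K)}\ \ge\ c_K\, n\, \|p\|_{L^q(\partial K)}$$ for all $n\ge n_0$ and all complex polynomials $p$ of degree exactly $n$ all of whose zeros lie in $K$. -/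

import Mathlib

open scoped ENNReal

/-- A convex polygonal domain in the complex plane: the convex hull of finitely many points
(hence compact and convex), with nonempty interior. -/
def IsConvexPolygonalDomain (K : Set ℂ) : Prop :=
  (∃ V : Finset ℂ, K = convexHull ℝ (V : Set ℂ)) ∧ (interior K).Nonempty

/-- The class of complex polynomials of degree exactly `n` all of whose complex zeros lie in
`K`. (The zero polynomial is excluded, its `degree` being `⊥`.) -/
def polynomialsWithZerosIn (n : ℕ) (K : Set ℂ) : Set (Polynomial ℂ) :=
  {p | p.degree = (n : WithBot ℕ) ∧ ∀ z : ℂ, p.IsRoot z → z ∈ K}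

/-- Arc length measure on the boundary of `K`: the one-dimensional Hausdorff measure
(normalized so that a segment has measure its length) restricted to the boundary. -/
noncomputable def boundaryArcLength (K : Set ℂ) : MeasureTheory.Measure ℂ :=
  (MeasureTheory.Measure.hausdorffMeasure 1).restrict (frontier K)

/-- The `L^q` (quasi-)norm `(∫_{∂K} |p(z)|^q |dz|)^(1/q)` of a polynomial on the boundary of
`K` with respect to arc length, for `0 < q < ∞`. -/
noncomputable def boundaryLqNorm (K : Set ℂ) (q : ℝ) (p : Polynomial ℂ) : ℝ≥0∞ :=
  (∫⁻ z, ‖p.eval z‖ₑ ^ q ∂(boundaryArcLength K)) ^ (1 / q)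

open MeasureTheory

/-! Up to the leading coefficient, |p| is `rootProd w` and p'/p is `recipSum w`, so |p'| ≥ c n |p|
at every boundary point where |`recipSum w`| ≥ c n. Call such points good. It suffices that the good
points carry a fixed share of ∫ |p|^q over the boundary.

At a bad point of a side, the component of p'/p normal to the side is small. As K lies on one side
of the supporting line, this component is a sum of nonnegative terms Im v / |x - v|², so the zeros
are on average close to that line. Away from the vertices (`exists_flat_gain`), moving a fixed
distance into K then multiplies |p| by e^(κn) on average, whence |p(x)| ≤ e^(-κn) max_K |p|. Near a
vertex there is no uniform room inside K, and a bad point at distance t is treated by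
`exists_wedge_dichotomy`. If at least a quarter of the zeros are within t of the vertex, |p| is
exponentially larger at a fixed distance from it. Otherwise many zeros lie close to the first side
and hence away from the second one; then the mean of log |p| over distances [t, (1 + γ)t] on the
second side is at least log |p(t)|, and that whole segment is good. Jensen's inequality and
`lintegral_average_le` turn this into a bound between integrals.

All comparisons use means of log |p| on segments: a zero may sit on the segment, but the mean of log
|x - w| over length τ is at least log τ - 2 wherever w is.

Compactness of the boundary gives ∫ |p|^q ≤ C (∫ over good points + (e^(-κn) max |p|)^q). By
`exists_nikolskii`, max |p|^q is at most a subexponential multiple of ∫ |p|^q, so the last term is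
absorbed for n ≥ N(q) (`exists_large_degree`). The finitely many remaining positive degrees follow
from crude two-sided bounds, so the threshold 1 serves every q. -/

/-- The modulus of the monic polynomial with zeros `w j`. -/
noncomputable def rootProd {n : ℕ} (w : Fin n → ℂ) (z : ℂ) : ℝ := ∏ j, ‖z - w j‖

/-- The logarithmic derivative of the monic polynomial with zeros `w j`. -/
noncomputable def recipSum {n : ℕ} (w : Fin n → ℂ) (z : ℂ) : ℂ := ∑ j, (z - w j)⁻¹

/-- The mean of `log |z - w|` over the points `z = z₀ + x e`, `a ≤ x ≤ a + τ`. -/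
noncomputable def avgLog (z₀ e : ℂ) (a τ : ℝ) (w : ℂ) : ℝ :=
  τ⁻¹ * ∫ x in a..(a + τ), Real.log ‖z₀ + x * e - w‖

/-! ### Means of log |z - w| on segments and Jensen's inequality. -/

theorem rootProd_nonneg {n : ℕ} (w : Fin n → ℂ) (z : ℂ) : 0 ≤ rootProd w z :=
  Finset.prod_nonneg fun _ _ => norm_nonneg _

theorem continuous_rootProd {n : ℕ} (w : Fin n → ℂ) : Continuous (rootProd w) := by
  unfold rootProd; fun_prop

theorem measurable_recipSum {n : ℕ} (w : Fin n → ℂ) : Measurable (recipSum w) := by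
  unfold recipSum; fun_prop

theorem intervalIntegrable_log_norm_line (z₀ e w : ℂ) (a b : ℝ) :
    IntervalIntegrable (fun x : ℝ => Real.log ‖z₀ + x * e - w‖) volume a b := by
  have hf : MeromorphicOn (fun x : ℝ => z₀ + x * e - w) (Set.uIcc a b) := by
    intro x _
    have h : AnalyticAt ℝ (fun x : ℝ => (x : ℂ)) x := Complex.ofRealCLM.analyticAt x
    exact ((analyticAt_const.add (h.mul analyticAt_const)).sub analyticAt_const).meromorphicAt
  exact hf.intervalIntegrable_log_norm

theorem norm_line_sub (z₀ e w : ℂ) (he : ‖e‖ = 1) (x : ℝ) :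
    ‖z₀ + x * e - w‖ = ‖(x : ℂ) - (w - z₀) * (starRingEnd ℂ) e‖ := by
  have h : e * (starRingEnd ℂ) e = 1 := by
    rw [Complex.mul_conj, Complex.normSq_eq_norm_sq, he]; simp
  have : z₀ + x * e - w = ((x : ℂ) - (w - z₀) * (starRingEnd ℂ) e) * e := by
    linear_combination (w - z₀) * h
  rw [this, norm_mul, he, mul_one]

/-- Since log is even, an interval [A, A + τ] avoiding 0 in its interior reduces to A ≥ 0, where
monotonicity of log is enough. If 0 lies inside, the tangent line bound is used at A + τ and at -A,
which add up to τ. -/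
theorem mul_log_sub_mul_log_ge {A τ : ℝ} (hτ : 0 < τ) :
    τ * (Real.log τ - 1) ≤ (A + τ) * Real.log (A + τ) - A * Real.log A := by
  -- The convex function y log y lies above its tangent line at τ.
  have key : ∀ y : ℝ, 0 ≤ y → y * Real.log τ + (y - τ) ≤ y * Real.log y := by
    intro y hy
    rcases hy.eq_or_lt with rfl | hy
    · simp [hτ.le]
    · have h := Real.add_one_le_exp (Real.log (τ / y))
      rw [Real.exp_log (by positivity), Real.log_div hτ.ne' hy.ne', le_div_iff₀ hy] at h
      nlinarith
  have mono : ∀ x y : ℝ, 0 ≤ x → 0 < y → τ = y - x →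
      τ * Real.log τ ≤ y * Real.log y - x * Real.log x := by
    intro x y hx hy h
    have h1 : Real.log τ ≤ Real.log y := Real.log_le_log hτ (by linarith)
    have h2 : x * Real.log x ≤ x * Real.log y := by
      rcases hx.eq_or_lt with rfl | hx
      · simp
      · exact mul_le_mul_of_nonneg_left (Real.log_le_log hx (by linarith)) hx.le
    have h3 : τ * Real.log y = y * Real.log y - x * Real.log y := by rw [h]; ring
    nlinarith
  rcases le_or_gt 0 A with hA | hA
  · have := mono A (A + τ) hA (by linarith) (by ring)
    linarith
  · rcases le_or_gt (A + τ) 0 with hB | hB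
    · have := mono (-(A + τ)) (-A) (by linarith) (by linarith) (by ring)
      rw [Real.log_neg_eq_log, Real.log_neg_eq_log] at this
      linarith
    · have h1 := key (A + τ) hB.le
      have h2 := key (-A) (by linarith)
      rw [Real.log_neg_eq_log] at h2
      linarith

/-- The distance to w is at least the distance to its projection on the line, which leaves an
explicit integral of log |x - v.re|. The bound is uniform in w, so it also covers zeros lying on the
segment. -/
theorem log_sub_two_le_avgLog {z₀ e : ℂ} (he : ‖e‖ = 1) {a τ : ℝ} (hτ : 0 < τ) (w : ℂ) :
    Real.log τ - 2 ≤ avgLog z₀ e a τ w := by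
  set v := (w - z₀) * (starRingEnd ℂ) e with hv
  have h1 : ∫ x in a..(a + τ), Real.log (x - v.re) ≤
      ∫ x in a..(a + τ), Real.log ‖z₀ + x * e - w‖ := by
    refine intervalIntegral.integral_mono_ae (by linarith) ?_
      (intervalIntegrable_log_norm_line z₀ e w a (a + τ)) ?_
    · have := (intervalIntegral.intervalIntegrable_log' (a := a - v.re) (b := a + τ - v.re)).comp_sub_right v.re
      simpa using this
    · have : ∀ᵐ x : ℝ, x ≠ v.re := by simp [ae_iff]
      filter_upwards [this] with x hx
      rw [norm_line_sub z₀ e w he, ← hv, ← Real.log_abs (x - v.re)]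
      refine Real.log_le_log (abs_pos.mpr (sub_ne_zero.mpr hx)) ?_
      simpa using Complex.abs_re_le_norm ((x : ℂ) - v)
  have h2 : ∫ x in a..(a + τ), Real.log (x - v.re) =
      (a - v.re + τ) * Real.log (a - v.re + τ) - (a - v.re) * Real.log (a - v.re) - τ := by
    rw [intervalIntegral.integral_comp_sub_right (fun x => Real.log x), integral_log]
    rw [show a + τ - v.re = a - v.re + τ by ring]; ring
  have h3 := mul_log_sub_mul_log_ge (A := a - v.re) hτ
  unfold avgLog
  rw [← div_eq_inv_mul, le_div_iff₀ hτ]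
  linarith

theorem le_avgLog_of_forall {z₀ e : ℂ} {a τ : ℝ} (hτ : 0 < τ) {w : ℂ} {y : ℝ}
    (h : ∀ x ∈ Set.Icc a (a + τ), y ≤ Real.log ‖z₀ + x * e - w‖) :
    y ≤ avgLog z₀ e a τ w := by
  have h1 : ∫ _ in a..(a + τ), y ≤ ∫ x in a..(a + τ), Real.log ‖z₀ + x * e - w‖ :=
    intervalIntegral.integral_mono_on (by linarith) (by simp)
      (intervalIntegrable_log_norm_line z₀ e w a (a + τ)) h
  rw [intervalIntegral.integral_const, smul_eq_mul] at h1
  unfold avgLog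
  rw [← div_eq_inv_mul, le_div_iff₀ hτ]
  linarith

/-- Jensen's inequality for `log |P|`, `P` a monic polynomial, on a segment. -/
theorem ofReal_mul_exp_le_lintegral_rootProd {n : ℕ} (w : Fin n → ℂ) {z₀ e : ℂ} (he : ‖e‖ = 1)
    {a τ q y : ℝ} (hτ : 0 < τ) (hq : 0 < q) (h : y ≤ ∑ j, avgLog z₀ e a τ (w j)) :
    ENNReal.ofReal (τ * Real.exp (q * y)) ≤
      ∫⁻ x in Set.Icc a (a + τ), ENNReal.ofReal (rootProd w (z₀ + (x : ℝ) * e) ^ q) := by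
  have hcont : Continuous fun x : ℝ => rootProd w (z₀ + x * e) ^ q :=
    ((continuous_rootProd w).comp (by fun_prop)).rpow_const fun _ => Or.inr hq.le
  have hint : IntegrableOn (fun x : ℝ => rootProd w (z₀ + x * e) ^ q) (Set.Icc a (a + τ)) :=
    hcont.continuousOn.integrableOn_Icc
  rw [← ofReal_integral_eq_lintegral_ofReal hint
    (Filter.Eventually.of_forall fun x => Real.rpow_nonneg (rootProd_nonneg _ _) _)]
  apply ENNReal.ofReal_le_ofReal
  rw [integral_Icc_eq_integral_Ioc, ← intervalIntegral.integral_of_le (by linarith)]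
  have hL : ∀ j ∈ (Finset.univ : Finset (Fin n)),
      IntervalIntegrable (fun x : ℝ => Real.log ‖z₀ + x * e - w j‖) volume a (a + τ) :=
    fun j _ => intervalIntegrable_log_norm_line z₀ e (w j) a (a + τ)
  have hS : IntervalIntegrable (fun x : ℝ => ∑ j, Real.log ‖z₀ + x * e - w j‖) volume a (a + τ) := by
    have := IntervalIntegrable.sum Finset.univ hL
    rwa [Finset.sum_fn] at this
  -- The integrand bound is exp s ≥ 1 + s with s = q (log P - y), valid off the finitely many
  -- parameters at which P may vanish.
  have h1 : ∫ x in a..(a + τ), Real.exp (q * y) *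
        (1 + q * (∑ j, Real.log ‖z₀ + x * e - w j‖ - y)) ≤
      ∫ x in a..(a + τ), rootProd w (z₀ + x * e) ^ q := by
    refine intervalIntegral.integral_mono_ae (by linarith) ?_ (hcont.intervalIntegrable _ _) ?_
    · exact (intervalIntegrable_const.add
        ((hS.sub intervalIntegrable_const).const_mul q)).const_mul _
    · have : ∀ᵐ x : ℝ, ∀ j, x ≠ ((w j - z₀) * (starRingEnd ℂ) e).re := by
        rw [ae_all_iff]; intro j; simp [ae_iff]
      filter_upwards [this] with x hx
      have hne : ∀ j, 0 < ‖z₀ + x * e - w j‖ := by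
        intro j
        rw [norm_line_sub z₀ e (w j) he, norm_pos_iff]
        intro h0
        exact hx j (by simpa [sub_eq_zero] using congrArg Complex.re h0)
      have hlog : ∑ j, Real.log ‖z₀ + x * e - w j‖ = Real.log (rootProd w (z₀ + x * e)) :=
        (Real.log_prod fun j _ => (hne j).ne').symm
      have hpos : 0 < rootProd w (z₀ + x * e) := Finset.prod_pos fun j _ => hne j
      rw [hlog, Real.rpow_def_of_pos hpos,
        show Real.log (rootProd w (z₀ + x * e)) * q =
          q * y + q * (Real.log (rootProd w (z₀ + x * e)) - y) by ring, Real.exp_add]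
      refine mul_le_mul_of_nonneg_left ?_ (Real.exp_pos _).le
      linarith [Real.add_one_le_exp (q * (Real.log (rootProd w (z₀ + x * e)) - y))]
  refine le_trans ?_ h1
  have h2 : ∫ x in a..(a + τ), ∑ j, Real.log ‖z₀ + x * e - w j‖ =
      τ * ∑ j, avgLog z₀ e a τ (w j) := by
    rw [intervalIntegral.integral_finsetSum hL, Finset.mul_sum]
    refine Finset.sum_congr rfl fun j _ => ?_
    unfold avgLog; rw [mul_inv_cancel_left₀ hτ.ne']
  rw [intervalIntegral.integral_const_mul, intervalIntegral.integral_add (by simp)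
    ((hS.sub (by simp)).const_mul q), intervalIntegral.integral_const_mul,
    intervalIntegral.integral_sub hS (by simp), h2]
  simp only [intervalIntegral.integral_const, smul_eq_mul, add_sub_cancel_left]
  have : 0 ≤ q * (τ * ∑ j, avgLog z₀ e a τ (w j) - τ * y) := by
    rw [← mul_sub]; exact mul_nonneg hq.le (mul_nonneg hτ.le (by linarith))
  nlinarith [Real.exp_pos (q * y)]

/-! ### Exponential gain perpendicular to a side. -/

theorem log_sub_two_mul_le_log {N X y : ℝ} (hN : 0 < N) (hy : y ≤ 1 / 2) (hy0 : 0 ≤ y)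
    (h : N * (1 - y) ≤ X) : Real.log N - 2 * y ≤ Real.log X := by
  have h1 : Real.log (N * (1 - y)) ≤ Real.log X := Real.log_le_log (by nlinarith) h
  rw [Real.log_mul hN.ne' (by linarith)] at h1
  have h2 := Real.one_sub_inv_le_log_of_pos (show 0 < 1 - y by linarith)
  have h3 : (1 - y)⁻¹ ≤ 1 + 2 * y := by
    rw [inv_le_iff_one_le_mul₀ (by linarith)]; nlinarith
  linarith

theorem half_log_add_le_log {N X y : ℝ} (hN : 0 < N) (hy0 : 0 ≤ y) (hy : y ≤ 1)
    (h : N ^ 2 * (1 + y) ≤ X ^ 2) : Real.log N + y / 4 ≤ Real.log X := by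
  have h1 : Real.log (N ^ 2 * (1 + y)) ≤ Real.log (X ^ 2) := Real.log_le_log (by positivity) h
  rw [Real.log_mul (by positivity) (by linarith), Real.log_pow, Real.log_pow] at h1
  have h2 := Real.one_sub_inv_le_log_of_pos (show 0 < 1 + y by linarith)
  have h3 : (1 + y)⁻¹ ≤ 1 - y / 2 := by
    rw [inv_le_iff_one_le_mul₀ (by linarith)]; nlinarith
  push_cast at h1
  linarith

/-- Points near a flat piece of the boundary where the logarithmic derivative is small: moving
perpendicularly to the boundary increases the polynomial exponentially. -/
theorem exists_flat_gain {h₀ d : ℝ} (hh : 0 < h₀) (hd : 0 < d) :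
    ∃ c > 0, ∃ κ > 0, ∀ (n : ℕ) (v : Fin n → ℂ) (x₀ : ℝ), (∀ j, 0 ≤ (v j).im) →
      (∀ j, ‖(x₀ : ℂ) - v j‖ ≤ d) → (∀ j, (x₀ : ℂ) ≠ v j) →
      ∑ j, (v j).im / ‖(x₀ : ℂ) - v j‖ ^ 2 < c * n →
      ∑ j, Real.log ‖(x₀ : ℂ) - v j‖ + κ * n ≤ ∑ j, avgLog x₀ Complex.I h₀ h₀ (v j) := by
  -- `y` is the relative increase of |x₀ - v|² for a zero of height at most h₀/4. `C` bounds the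
  -- loss caused by a higher zero, and `D` is so large that the subtracted term of such a zero pays
  -- for this loss and for the gain `y / 4` credited to it.
  set y := min 1 (h₀ ^ 2 / (2 * d ^ 2)) with hy
  have hy0 : 0 < y := by positivity
  set C := |Real.log d| + |Real.log h₀| + 2 with hC
  have hCpos : 0 < C := by positivity
  set D := (y / 4 + C) * (d ^ 2 / (h₀ / 4)) with hD
  have hDpos : 0 < D := by positivity
  -- With this threshold the subtracted terms use up at most half of the total gain `y / 4 * n`.
  refine ⟨y / (8 * D), by positivity, y / 8, by positivity, ?_⟩
  intro n v x₀ him hdist hne hsum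
  have key : ∀ j, Real.log ‖(x₀ : ℂ) - v j‖ + y / 4 - D * ((v j).im / ‖(x₀ : ℂ) - v j‖ ^ 2) ≤
      avgLog x₀ Complex.I h₀ h₀ (v j) := by
    intro j
    have hr : 0 < ‖(x₀ : ℂ) - v j‖ := norm_pos_iff.mpr (sub_ne_zero.mpr (hne j))
    rcases le_or_gt (v j).im (h₀ / 4) with hl | hl
    · have hq : 0 ≤ D * ((v j).im / ‖(x₀ : ℂ) - v j‖ ^ 2) :=
        mul_nonneg hDpos.le (div_nonneg (him j) (by positivity))
      refine le_trans (by linarith : _ ≤ Real.log ‖(x₀ : ℂ) - v j‖ + y / 4)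
        (le_avgLog_of_forall hh ?_)
      rintro x ⟨hx1, hx2⟩
      refine half_log_add_le_log hr hy0.le (min_le_left _ _) ?_
      have e1 : ‖(x₀ : ℂ) + x * Complex.I - v j‖ ^ 2 = ‖(x₀ : ℂ) - v j‖ ^ 2 + x ^ 2 - 2 * x * (v j).im := by
        rw [Complex.sq_norm, Complex.sq_norm, Complex.normSq_apply, Complex.normSq_apply]
        simp; ring
      have e2 : ‖(x₀ : ℂ) - v j‖ ^ 2 * y ≤ d ^ 2 * (h₀ ^ 2 / (2 * d ^ 2)) :=
        mul_le_mul (pow_le_pow_left₀ hr.le (hdist j) 2) (min_le_right _ _) hy0.le (by positivity)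
      have e3 : d ^ 2 * (h₀ ^ 2 / (2 * d ^ 2)) = h₀ ^ 2 / 2 := by field_simp
      rw [e1]
      nlinarith
    · have h1 : 1 / (d ^ 2 / (h₀ / 4)) ≤ (v j).im / ‖(x₀ : ℂ) - v j‖ ^ 2 := by
        rw [one_div_div]
        exact div_le_div₀ (him j) hl.le (by positivity) (pow_le_pow_left₀ hr.le (hdist j) 2)
      have h2 : y / 4 + C ≤ D * ((v j).im / ‖(x₀ : ℂ) - v j‖ ^ 2) := by
        calc y / 4 + C = D * (1 / (d ^ 2 / (h₀ / 4))) := by rw [hD]; field_simp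
          _ ≤ _ := mul_le_mul_of_nonneg_left h1 hDpos.le
      have h3 := log_sub_two_le_avgLog (z₀ := x₀) (e := Complex.I) (by simp) (a := h₀) hh (v j)
      have h4 := Real.log_le_log hr (hdist j)
      have h5 := le_abs_self (Real.log d)
      have h6 := neg_abs_le (Real.log h₀)
      linarith
  have hs := Finset.sum_le_sum fun j (_ : j ∈ Finset.univ) => key j
  rw [Finset.sum_sub_distrib, Finset.sum_add_distrib, ← Finset.mul_sum] at hs
  simp only [Finset.sum_const, Finset.card_univ, Fintype.card_fin, nsmul_eq_mul] at hs
  have h7 : D * ∑ j, (v j).im / ‖(x₀ : ℂ) - v j‖ ^ 2 ≤ D * (y / (8 * D) * n) :=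
    mul_le_mul_of_nonneg_left hsum.le hDpos.le
  have h8 : D * (y / (8 * D) * n) = y / 8 * n := by field_simp
  linarith

/-! ### Comparison of the two sides at a vertex. -/

/-- Up to a scale-invariant loss, passing from `t` to the points of the segment
`[t e, (1 + γ) t e]` does not decrease the mean of `log |· - v|`. -/
theorem exists_le_avgLog_rotate {γ : ℝ} (hγ : 0 < γ) (hγ1 : γ ≤ 1) :
    ∃ C > 0, ∀ (e v : ℂ) (t : ℝ), ‖e‖ = 1 → 0 < t → (t : ℂ) ≠ v →
      Real.log ‖(t : ℂ) - v‖ - C * (t * ‖v‖ / (‖v‖ + t) ^ 2) ≤ avgLog 0 e t (γ * t) v := by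
  have hl : 0 ≤ Real.log (9 / γ) := Real.log_nonneg (by rw [le_div_iff₀ hγ]; linarith)
  -- 16 serves the regimes in which t and |v| differ by a factor of at least 8, where the loss is
  -- linear in the small ratio. Between them 11 t|v| / (|v| + t)² ≥ 1, so the crude loss `log (9 /
  -- γ) + 2` is affordable.
  refine ⟨16 + 11 * (Real.log (9 / γ) + 2), by positivity, ?_⟩
  intro e v t he ht hne
  have hr : 0 < ‖(t : ℂ) - v‖ := norm_pos_iff.mpr (sub_ne_zero.mpr hne)
  set s := ‖v‖ with hs
  have hs0 : 0 ≤ s := norm_nonneg v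
  have hnt : ‖(t : ℂ)‖ = t := by simp [abs_of_pos ht]
  have hγt : 0 < γ * t := by positivity
  have hxe : ∀ x ∈ Set.Icc t (t + γ * t), ‖(x : ℂ) * e‖ = x ∧ x ≤ 2 * t := by
    rintro x ⟨h1, h2⟩
    refine ⟨by simp [he, abs_of_pos (ht.trans_le h1)], by nlinarith⟩
  have hu : ‖(t : ℂ) - v‖ ≤ t + s := (norm_sub_le (t : ℂ) v).trans_eq (by rw [hnt])
  have hfac : 0 ≤ t * s / (s + t) ^ 2 := by positivity
  rcases le_or_gt (8 * t) s with h8 | h8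
  · have hy : 16 * (t * s / (s + t) ^ 2) ≥ 2 * (4 * t / s) := by
      have : 0 < s := by linarith
      rw [ge_iff_le, ← mul_div_assoc, ← mul_div_assoc, div_le_div_iff₀ (by positivity) (by positivity)]
      nlinarith [mul_pos ht this, mul_nonneg (mul_pos ht this).le (sub_nonneg.mpr h8)]
    refine le_trans (by nlinarith : _ ≤ Real.log ‖(t : ℂ) - v‖ - 2 * (4 * t / s))
      (le_avgLog_of_forall hγt ?_)
    intro x hx
    obtain ⟨hx1, hx2⟩ := hxe x hx
    have hspos : 0 < s := by linarith
    refine log_sub_two_mul_le_log hr (by rw [div_le_iff₀ hspos]; linarith) (by positivity) ?_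
    have h1 : ‖(t : ℂ) - v‖ ≤ ‖0 + (x : ℂ) * e - v‖ + ‖(x : ℂ) * e - t‖ := by
      calc ‖(t : ℂ) - v‖ = ‖(0 + (x : ℂ) * e - v) - ((x : ℂ) * e - t)‖ := by ring_nf
        _ ≤ _ := norm_sub_le _ _
    have h2 : ‖(x : ℂ) * e - t‖ ≤ 3 * t := by
      have := norm_sub_le ((x : ℂ) * e) (t : ℂ)
      rw [hx1, hnt] at this; linarith
    have h3 : s ≤ ‖(t : ℂ) - v‖ + t := by
      calc s = ‖(t : ℂ) - ((t : ℂ) - v)‖ := by rw [sub_sub_cancel]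
        _ ≤ ‖(t : ℂ)‖ + ‖(t : ℂ) - v‖ := norm_sub_le _ _
        _ = _ := by rw [hnt]; ring
    have h4 : 3 * t ≤ ‖(t : ℂ) - v‖ * (4 * t / s) := by
      rw [← mul_div_assoc, le_div_iff₀ hspos]
      nlinarith
    linarith
  rcases le_or_gt (8 * s) t with h9 | h9
  · have hy : 16 * (t * s / (s + t) ^ 2) ≥ 2 * (2 * s / t) := by
      rw [ge_iff_le, ← mul_div_assoc, ← mul_div_assoc, div_le_div_iff₀ (by positivity) (by positivity)]
      nlinarith [mul_nonneg ht.le hs0, mul_nonneg (mul_nonneg ht.le hs0) (sub_nonneg.mpr h9),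
        mul_nonneg (mul_nonneg ht.le hs0) ht.le, mul_nonneg (mul_nonneg hs0 hs0) (sub_nonneg.mpr h9)]
    refine le_trans (by nlinarith : _ ≤ Real.log ‖(t : ℂ) - v‖ - 2 * (2 * s / t))
      (le_avgLog_of_forall hγt ?_)
    intro x hx
    obtain ⟨hx1, hx2⟩ := hxe x hx
    refine log_sub_two_mul_le_log hr (by rw [div_le_iff₀ ht]; linarith) (by positivity) ?_
    have h1 : x - s ≤ ‖0 + (x : ℂ) * e - v‖ := by
      have := norm_sub_norm_le ((x : ℂ) * e) v
      rw [hx1] at this; simpa using this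
    have hyy : 0 ≤ 1 - 2 * s / t := by rw [sub_nonneg, div_le_iff₀ ht]; linarith
    have h2 : ‖(t : ℂ) - v‖ * (1 - 2 * s / t) ≤ (t + s) * (1 - 2 * s / t) :=
      mul_le_mul_of_nonneg_right hu hyy
    have h3 : (t + s) * (1 - 2 * s / t) ≤ t - s := by
      have : (t + s) * (1 - 2 * s / t) = t - s - 2 * s * s / t := by field_simp; ring
      rw [this]; have : 0 ≤ 2 * s * s / t := by positivity
      linarith
    linarith [hx.1]
  · have h1 := log_sub_two_le_avgLog (z₀ := 0) he (a := t) hγt v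
    have h2 : Real.log ‖(t : ℂ) - v‖ ≤ Real.log (9 / γ * (γ * t)) := by
      refine Real.log_le_log hr (hu.trans ?_)
      rw [show 9 / γ * (γ * t) = 9 * t by field_simp]; linarith
    rw [Real.log_mul (by positivity) (by positivity)] at h2
    have h3 : 1 ≤ 11 * (t * s / (s + t) ^ 2) := by
      have : 0 < s := by linarith
      rw [← mul_div_assoc, le_div_iff₀ (by positivity)]
      nlinarith [mul_pos (sub_pos.mpr h8) (sub_pos.mpr h9)]
    nlinarith

theorem re_lt_one_of_im_pos {e : ℂ} (he : ‖e‖ = 1) (hB : 0 < e.im) : e.re < 1 := by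
  have h : e.re * e.re + e.im * e.im = 1 := by
    rw [← Complex.normSq_apply, Complex.normSq_eq_norm_sq, he, one_pow]
  nlinarith

/-- A point of the wedge between the directions `1` and `e` which makes a small angle with the
direction `1` is farther from the ray along `e`. -/
theorem wedge_low {e v : ℂ} (he : ‖e‖ = 1) (hB : 0 < e.im) (hv0 : 0 ≤ v.im)
    (hve : (v * (starRingEnd ℂ) e).im ≤ 0)
    (hlow : v.im < min (e.im / 4) ((1 - e.re) / 4) * ‖v‖) :
    (1 - e.re) / 4 * ‖v‖ ≤ v.re - (v * (starRingEnd ℂ) e).re ∧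
      e.im / 2 * ‖v‖ ≤ -(v * (starRingEnd ℂ) e).im := by
  have h1 : e.re * e.re + e.im * e.im = 1 := by
    rw [← Complex.normSq_apply, Complex.normSq_eq_norm_sq, he, one_pow]
  have hA := re_lt_one_of_im_pos he hB
  have hA' : -1 < e.re := by nlinarith
  have hB1 : e.im ≤ 1 := by nlinarith
  have hs : 0 ≤ ‖v‖ := norm_nonneg v
  have hm1 : v.im < e.im / 4 * ‖v‖ :=
    hlow.trans_le (mul_le_mul_of_nonneg_right (min_le_left _ _) hs)
  have hm2 : v.im < (1 - e.re) / 4 * ‖v‖ :=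
    hlow.trans_le (mul_le_mul_of_nonneg_right (min_le_right _ _) hs)
  have hn : ‖v‖ ≤ |v.re| + v.im := by
    simpa [abs_of_nonneg hv0] using Complex.norm_le_abs_re_add_abs_im v
  simp only [Complex.mul_im, Complex.mul_re, Complex.conj_re, Complex.conj_im] at hve ⊢
  have ha : 0 < v.re := by
    by_contra hcon
    push Not at hcon
    rw [abs_of_nonpos hcon] at hn
    have h2 : -v.re * e.im ≤ v.im := by nlinarith
    have h3 : ‖v‖ * e.im ≤ v.im * (1 + e.im) := by nlinarith
    nlinarith
  rw [abs_of_pos ha] at hn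
  constructor
  · nlinarith
  · nlinarith

theorem norm_sq_line_sub {e : ℂ} (he : ‖e‖ = 1) (v : ℂ) (x : ℝ) :
    ‖(x : ℂ) * e - v‖ ^ 2 = x ^ 2 + ‖v‖ ^ 2 - 2 * x * (v * (starRingEnd ℂ) e).re := by
  have h1 : e.re * e.re + e.im * e.im = 1 := by
    rw [← Complex.normSq_apply, Complex.normSq_eq_norm_sq, he, one_pow]
  simp only [Complex.sq_norm, Complex.normSq_apply, Complex.sub_re, Complex.sub_im, Complex.mul_re,
    Complex.mul_im, Complex.ofReal_re, Complex.ofReal_im, Complex.conj_re, Complex.conj_im]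
  linear_combination x ^ 2 * h1

/-- By the law of cosines, turning from direction 1 to e raises the squared distance to v by at
least (1 - Re e)/4 · t|v|; the bound on γ keeps the stretching from t to x from consuming this. For
t ≤ |v| the relative gain is of order t/|v|, hence at least a constant times t. -/
theorem wedge_low_gain {e v : ℂ} (he : ‖e‖ = 1) (hB : 0 < e.im) {γ t d : ℝ}
    (hγ : γ ≤ (1 - e.re) / 8) (ht : 0 < t) (hvd : ‖v‖ ≤ d)
    (hne : (t : ℂ) ≠ v) (hlow : (1 - e.re) / 4 * ‖v‖ ≤ v.re - (v * (starRingEnd ℂ) e).re)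
    {x : ℝ} (hx : x ∈ Set.Icc t (t + γ * t)) :
    Real.log ‖(t : ℂ) - v‖ + t * (if t ≤ ‖v‖ then (1 - e.re) / (64 * d) else 0) ≤
      Real.log ‖(x : ℂ) * e - v‖ := by
  have hA := re_lt_one_of_im_pos he hB
  have hA2 : -1 ≤ e.re := by
    have := Complex.abs_re_le_norm e
    rw [he] at this
    exact (abs_le.mp this).1
  have hr : 0 < ‖(t : ℂ) - v‖ := norm_pos_iff.mpr (sub_ne_zero.mpr hne)
  set s := ‖v‖ with hs
  have hs0 : 0 ≤ s := norm_nonneg v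
  set R := (v * (starRingEnd ℂ) e).re with hR
  have hRs : R ≤ s := by
    have := Complex.re_le_norm (v * (starRingEnd ℂ) e)
    rwa [norm_mul, RCLike.norm_conj, he, mul_one] at this
  have e1 := norm_sq_line_sub he v x
  have e2 : ‖(t : ℂ) - v‖ ^ 2 = t ^ 2 + s ^ 2 - 2 * t * v.re := by
    simpa using norm_sq_line_sub (e := 1) (by simp) v t
  obtain ⟨hx1, hx2⟩ := hx
  have hdiff : ‖(t : ℂ) - v‖ ^ 2 + (1 - e.re) / 4 * (s * t) ≤ ‖(x : ℂ) * e - v‖ ^ 2 := by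
    rw [e1, e2, ← hR, ← hs]
    have a1 : (x - t) * R ≤ (1 - e.re) / 8 * t * s := by
      have b1 : (x - t) * R ≤ (x - t) * s := mul_le_mul_of_nonneg_left hRs (by linarith)
      have b2 : (x - t) * s ≤ ((1 - e.re) / 8 * t) * s := by
        refine mul_le_mul_of_nonneg_right ?_ hs0
        nlinarith
      linarith
    have a2 : t * ((1 - e.re) / 4 * s) ≤ t * (v.re - R) := mul_le_mul_of_nonneg_left hlow ht.le
    nlinarith
  split_ifs with hts
  · have hspos : 0 < s := ht.trans_le hts
    have hu : ‖(t : ℂ) - v‖ ≤ 2 * s := by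
      refine (norm_sub_le _ _).trans ?_
      rw [Complex.norm_real, Real.norm_eq_abs, abs_of_pos ht]; linarith
    have hd : 0 < d := hspos.trans_le hvd
    have hy1 : (1 - e.re) * t / (16 * s) ≤ 1 := by
      rw [div_le_one (by positivity)]; nlinarith
    have h := half_log_add_le_log (y := (1 - e.re) * t / (16 * s)) (X := ‖(x : ℂ) * e - v‖) hr
      (div_nonneg (mul_nonneg (by linarith) ht.le) (by positivity)) hy1 ?_
    · refine le_trans ?_ h
      have : t * ((1 - e.re) / (64 * d)) ≤ (1 - e.re) * t / (16 * s) / 4 := by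
        rw [← mul_div_assoc, div_div]
        rw [mul_comm t]
        exact div_le_div_of_nonneg_left (mul_nonneg (by linarith) ht.le) (by positivity)
          (by linarith)
      linarith
    · refine le_trans ?_ hdiff
      rw [mul_add, mul_one]
      have : ‖(t : ℂ) - v‖ ^ 2 * ((1 - e.re) * t / (16 * s)) ≤
          (2 * s) ^ 2 * ((1 - e.re) * t / (16 * s)) :=
        mul_le_mul_of_nonneg_right (pow_le_pow_left₀ hr.le hu 2)
          (div_nonneg (mul_nonneg (by linarith) ht.le) (by positivity))
      have e3 : (2 * s) ^ 2 * ((1 - e.re) * t / (16 * s)) = (1 - e.re) / 4 * (s * t) := by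
        field_simp; ring
      linarith
  · rw [mul_zero, add_zero]
    refine Real.log_le_log hr ((sq_le_sq₀ hr.le (norm_nonneg _)).mp ?_)
    have : 0 ≤ (1 - e.re) / 4 * (s * t) :=
      mul_nonneg (by linarith) (mul_nonneg hs0 ht.le)
    linarith

/-- The contribution of one zero `v` of the wedge to the comparison between the point `t` of the
first ray and nearby points of the second ray. -/
theorem exists_wedge_gain {e : ℂ} (he : ‖e‖ = 1) (hB : 0 < e.im) {d : ℝ} (hd : 0 < d) :
    ∃ γ > 0, γ ≤ 1 ∧ ∃ D > 0, ∀ (t : ℝ) (v : ℂ), 0 < t → 0 ≤ v.im →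
      (v * (starRingEnd ℂ) e).im ≤ 0 → ‖v‖ ≤ d → (t : ℂ) ≠ v →
      Real.log ‖(t : ℂ) - v‖ + t * ((if t ≤ ‖v‖ then (1 - e.re) / (64 * d) else 0) -
        D * (v.im / ‖(t : ℂ) - v‖ ^ 2)) ≤ avgLog 0 e t (γ * t) v := by
  have hA := re_lt_one_of_im_pos he hB
  have hγ : 0 < min 1 ((1 - e.re) / 8) := lt_min one_pos (by linarith)
  refine ⟨min 1 ((1 - e.re) / 8), hγ, min_le_left _ _, ?_⟩
  obtain ⟨C, hC, hloss⟩ := exists_le_avgLog_rotate hγ (min_le_left _ _)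
  set m := min (e.im / 4) ((1 - e.re) / 4) with hm
  have hmpos : 0 < m := lt_min (by linarith) (by linarith)
  -- For a zero at a large angle, `C` pays the rotation loss and `1 - e.re` the gain credited to it
  -- without being earned.
  refine ⟨(C + (1 - e.re)) / m, div_pos (by linarith) hmpos, ?_⟩
  intro t v ht hv0 hve hvd hne
  have hr : 0 < ‖(t : ℂ) - v‖ := norm_pos_iff.mpr (sub_ne_zero.mpr hne)
  have hDpos : 0 < (C + (1 - e.re)) / m := div_pos (by linarith) hmpos
  rcases lt_or_ge v.im (m * ‖v‖) with hl | hl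
  · have h1 := (wedge_low he hB hv0 hve hl).1
    have hq : 0 ≤ t * ((C + (1 - e.re)) / m * (v.im / ‖(t : ℂ) - v‖ ^ 2)) := by positivity
    refine le_trans (by rw [mul_sub]; linarith : _ ≤ Real.log ‖(t : ℂ) - v‖ +
      t * (if t ≤ ‖v‖ then (1 - e.re) / (64 * d) else 0)) (le_avgLog_of_forall (by positivity) ?_)
    intro x hx
    rw [zero_add]
    exact wedge_low_gain he hB (min_le_right _ _) ht hvd hne h1 hx
  · refine le_trans ?_ (hloss e v t he ht hne)
    have hu : ‖(t : ℂ) - v‖ ≤ ‖v‖ + t := by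
      refine (norm_sub_le _ _).trans ?_
      rw [Complex.norm_real, Real.norm_eq_abs, abs_of_pos ht]; linarith
    have hs0 : 0 ≤ ‖v‖ := norm_nonneg v
    have hq : m * (‖v‖ / (‖v‖ + t) ^ 2) ≤ v.im / ‖(t : ℂ) - v‖ ^ 2 := by
      rw [← mul_div_assoc]
      exact div_le_div₀ hv0 hl (by positivity) (pow_le_pow_left₀ hr.le hu 2)
    have hq2 : (C + (1 - e.re)) * (‖v‖ / (‖v‖ + t) ^ 2) ≤
        (C + (1 - e.re)) / m * (v.im / ‖(t : ℂ) - v‖ ^ 2) := by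
      calc _ = (C + (1 - e.re)) / m * (m * (‖v‖ / (‖v‖ + t) ^ 2)) := by field_simp
        _ ≤ _ := mul_le_mul_of_nonneg_left hq hDpos.le
    have hi : (if t ≤ ‖v‖ then (1 - e.re) / (64 * d) else 0) ≤
        (1 - e.re) * (‖v‖ / (‖v‖ + t) ^ 2) := by
      split_ifs with hts
      · have hspos : 0 < ‖v‖ := ht.trans_le hts
        rw [← mul_div_assoc, div_le_div_iff₀ (by positivity) (by positivity), mul_assoc]
        refine mul_le_mul_of_nonneg_left ?_ (by linarith)
        nlinarith
      · exact mul_nonneg (by linarith) (by positivity)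
    have hfin : (if t ≤ ‖v‖ then (1 - e.re) / (64 * d) else 0) -
        (C + (1 - e.re)) / m * (v.im / ‖(t : ℂ) - v‖ ^ 2) ≤ -(C * (‖v‖ / (‖v‖ + t) ^ 2)) := by
      linarith
    have := mul_le_mul_of_nonneg_left hfin ht.le
    have e1 : t * -(C * (‖v‖ / (‖v‖ + t) ^ 2)) = -(C * (t * ‖v‖ / (‖v‖ + t) ^ 2)) := by ring
    linarith

/-- The contribution of one zero `v` of the wedge to the logarithmic derivative at points of the
second ray. -/
theorem exists_wedge_good {e : ℂ} (he : ‖e‖ = 1) (hB : 0 < e.im) {d : ℝ} (hd : 0 < d) :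
    ∃ D > 0, ∀ (t x : ℝ) (v : ℂ), 0 < t → t ≤ x → x ≤ 2 * t → 0 ≤ v.im →
      (v * (starRingEnd ℂ) e).im ≤ 0 → ‖v‖ ≤ d → (t : ℂ) ≠ v →
      (if t ≤ ‖v‖ then e.im / (18 * d) else 0) - D * (v.im / ‖(t : ℂ) - v‖ ^ 2) ≤
        -(v * (starRingEnd ℂ) e).im / ‖(x : ℂ) * e - v‖ ^ 2 := by
  have hA := re_lt_one_of_im_pos he hB
  set m := min (e.im / 4) ((1 - e.re) / 4) with hm
  have hmpos : 0 < m := lt_min (by linarith) (by linarith)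
  -- For a zero with `m * ‖v‖ ≤ v.im` and `t ≤ ‖v‖`, the subtracted term alone already exceeds `e.im
  -- / (18 * d)`.
  refine ⟨e.im / m, by positivity, ?_⟩
  intro t x v ht htx hx2 hv0 hve hvd hne
  have hr : 0 < ‖(t : ℂ) - v‖ := norm_pos_iff.mpr (sub_ne_zero.mpr hne)
  have hD : 0 ≤ e.im / m * (v.im / ‖(t : ℂ) - v‖ ^ 2) := by positivity
  have hR : 0 ≤ -(v * (starRingEnd ℂ) e).im / ‖(x : ℂ) * e - v‖ ^ 2 :=
    div_nonneg (by linarith) (by positivity)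
  split_ifs with hts
  · have hspos : 0 < ‖v‖ := ht.trans_le hts
    rcases lt_or_ge v.im (m * ‖v‖) with hl | hl
    · have h1 := (wedge_low he hB hv0 hve hl).2
      have hxr : 0 < ‖(x : ℂ) * e - v‖ := by
        rw [norm_pos_iff, sub_ne_zero]
        rintro rfl
        have : 0 < e.im / 2 * ‖(x : ℂ) * e‖ := by positivity
        have h2 : ((x : ℂ) * e * (starRingEnd ℂ) e).im = 0 := by
          rw [mul_assoc, Complex.mul_conj, ← Complex.ofReal_mul, Complex.ofReal_im]
        linarith
      have hxu : ‖(x : ℂ) * e - v‖ ≤ 3 * ‖v‖ := by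
        refine (norm_sub_le _ _).trans ?_
        rw [norm_mul, he, mul_one, Complex.norm_real, Real.norm_eq_abs, abs_of_pos (by linarith)]
        linarith
      have : e.im / (18 * d) ≤ -(v * (starRingEnd ℂ) e).im / ‖(x : ℂ) * e - v‖ ^ 2 := by
        calc e.im / (18 * d) ≤ e.im / (18 * ‖v‖) :=
              div_le_div_of_nonneg_left hB.le (by positivity) (by linarith)
          _ = (e.im / 2 * ‖v‖) / (3 * ‖v‖) ^ 2 := by field_simp; norm_num
          _ ≤ _ := div_le_div₀ (by linarith) h1 (by positivity) (pow_le_pow_left₀ hxr.le hxu 2)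
      linarith
    · have hu : ‖(t : ℂ) - v‖ ≤ 2 * ‖v‖ := by
        refine (norm_sub_le _ _).trans ?_
        rw [Complex.norm_real, Real.norm_eq_abs, abs_of_pos ht]; linarith
      have : e.im / (18 * d) ≤ e.im / m * (v.im / ‖(t : ℂ) - v‖ ^ 2) := by
        calc e.im / (18 * d) ≤ e.im / (4 * ‖v‖) :=
              div_le_div_of_nonneg_left hB.le (by positivity) (by linarith)
          _ = e.im / m * ((m * ‖v‖) / (2 * ‖v‖) ^ 2) := by field_simp; norm_num
          _ ≤ _ := mul_le_mul_of_nonneg_left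
            (div_le_div₀ hv0 hl (by positivity) (pow_le_pow_left₀ hr.le hu 2)) (by positivity)
      linarith
  · linarith

/-- Points of the first ray near the vertex where the logarithmic derivative is small: either the
polynomial is exponentially larger at a definite distance from the vertex, or it is larger on average
on the second ray, in a place where the logarithmic derivative is not small. -/
theorem exists_wedge_dichotomy {e : ℂ} (he : ‖e‖ = 1) (hB : 0 < e.im) {d τ : ℝ} (hd : 0 < d)
    (hτ : 0 < τ) :
    ∃ c > 0, ∃ γ > 0, γ ≤ 1 ∧ ∃ η > 0, ∀ (n : ℕ) (v : Fin n → ℂ) (t : ℝ), 0 < t → t ≤ η →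
      (∀ j, 0 ≤ (v j).im) → (∀ j, (v j * (starRingEnd ℂ) e).im ≤ 0) → (∀ j, ‖v j‖ ≤ d) →
      (∀ j, (t : ℂ) ≠ v j) → ∑ j, (v j).im / ‖(t : ℂ) - v j‖ ^ 2 < c * n →
      ∑ j, Real.log ‖(t : ℂ) - v j‖ + n ≤ ∑ j, avgLog 0 1 τ τ (v j) ∨
      ∑ j, Real.log ‖(t : ℂ) - v j‖ ≤ ∑ j, avgLog 0 e t (γ * t) (v j) ∧
        ∀ x ∈ Set.Icc t (t + γ * t),
          c * n ≤ ∑ j, -(v j * (starRingEnd ℂ) e).im / ‖(x : ℂ) * e - v j‖ ^ 2 := by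
  have hA := re_lt_one_of_im_pos he hB
  obtain ⟨γ, hγ, hγ1, D, hD, hgain⟩ := exists_wedge_gain he hB hd
  obtain ⟨D', hD', hgood⟩ := exists_wedge_good he hB hd
  set g := (1 - e.re) / (64 * d) with hg
  have hgpos : 0 < g := div_pos (by linarith) (by positivity)
  set b := e.im / (18 * d) with hb
  have hbpos : 0 < b := by positivity
  set C := |Real.log (2 * d)| + |Real.log τ| + 2 with hC
  have hCpos : 0 < C := by positivity
  set c := min (g / (2 * D)) (b / (2 * (1 + D'))) with hc
  have hcpos : 0 < c := lt_min (by positivity) (by positivity)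
  -- A zero with |v| < t ≤ η has log |t - v| ≤ -(5C + 4), while its mean over [τ, 2τ] is at least
  -- -C.
  set η := min d (Real.exp (-(5 * C + 4)) / 2) with hη
  refine ⟨c, hcpos, γ, hγ, hγ1, η, by positivity, ?_⟩
  intro n v t ht htη hv0 hve hvd hne hsum
  have hcard : ∑ j, (if t ≤ ‖v j‖ then (1 : ℝ) else 0) + ∑ j, (if t ≤ ‖v j‖ then (0 : ℝ) else 1) = n := by
    rw [← Finset.sum_add_distrib]
    have : ∀ j, ((if t ≤ ‖v j‖ then (1 : ℝ) else 0) + if t ≤ ‖v j‖ then (0 : ℝ) else 1) = 1 := by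
      intro j; split_ifs <;> simp
    simp [this]
  set F := ∑ j, (if t ≤ ‖v j‖ then (1 : ℝ) else 0) with hF
  have hmul : ∀ y : ℝ, ∑ j, (if t ≤ ‖v j‖ then y else 0) = y * F := by
    intro y; rw [hF, Finset.mul_sum]
    exact Finset.sum_congr rfl fun j _ => by split_ifs <;> simp
  have hn : (0 : ℝ) ≤ n := n.cast_nonneg
  -- If at least n/4 zeros are nearer than t, each gains 3C + 4 and every other one loses at most C,
  -- a net gain of n. Otherwise the far zeros contribute g F ≥ (3/4) g n, more than the subtracted
  -- terms, which total at most g n / 2; the same count with b makes the second segment good.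
  rcases le_or_gt F (3 / 4 * n) with hfar | hfar
  · left
    have key : ∀ j, Real.log ‖(t : ℂ) - v j‖ + ((4 * C + 4) * (if t ≤ ‖v j‖ then (0 : ℝ) else 1) - C) ≤
        avgLog 0 1 τ τ (v j) := by
      intro j
      have hr : 0 < ‖(t : ℂ) - v j‖ := norm_pos_iff.mpr (sub_ne_zero.mpr (hne j))
      have h3 := log_sub_two_le_avgLog (z₀ := 0) (e := 1) (by simp) (a := τ) hτ (v j)
      have hu : ‖(t : ℂ) - v j‖ ≤ t + ‖v j‖ := by
        refine (norm_sub_le _ _).trans ?_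
        rw [Complex.norm_real, Real.norm_eq_abs, abs_of_pos ht]
      have h6 := neg_abs_le (Real.log τ)
      split_ifs with hts
      · have h4 := Real.log_le_log hr (hu.trans (by linarith [htη.trans (min_le_left _ _), hvd j] :
          t + ‖v j‖ ≤ 2 * d))
        have h5 := le_abs_self (Real.log (2 * d))
        linarith
      · have h4 := Real.log_le_log hr (hu.trans (by linarith [htη.trans (min_le_right _ _)] :
          t + ‖v j‖ ≤ Real.exp (-(5 * C + 4))))
        rw [Real.log_exp] at h4
        have := abs_nonneg (Real.log (2 * d))
        linarith
    have hs := Finset.sum_le_sum fun j (_ : j ∈ Finset.univ) => key j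
    rw [Finset.sum_add_distrib, Finset.sum_sub_distrib, ← Finset.mul_sum] at hs
    simp only [Finset.sum_const, Finset.card_univ, Fintype.card_fin, nsmul_eq_mul] at hs
    nlinarith
  · right
    have hc1 : D * ∑ j, (v j).im / ‖(t : ℂ) - v j‖ ^ 2 ≤ g / 2 * n := by
      calc _ ≤ D * (c * n) := mul_le_mul_of_nonneg_left hsum.le hD.le
        _ ≤ D * (g / (2 * D) * n) := by gcongr; exact min_le_left _ _
        _ = _ := by field_simp
    have hc2 : (1 + D') * (c * n) ≤ b / 2 * n := by
      calc _ ≤ (1 + D') * (b / (2 * (1 + D')) * n) := by gcongr; exact min_le_right _ _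
        _ = _ := by field_simp
    constructor
    · have hs := Finset.sum_le_sum fun j (_ : j ∈ Finset.univ) =>
        hgain t (v j) ht (hv0 j) (hve j) (hvd j) (hne j)
      rw [Finset.sum_add_distrib, ← Finset.mul_sum, Finset.sum_sub_distrib, ← Finset.mul_sum,
        hmul] at hs
      have : 0 ≤ t * (g * F - D * ∑ j, (v j).im / ‖(t : ℂ) - v j‖ ^ 2) :=
        mul_nonneg ht.le (by nlinarith)
      linarith
    · intro x hx
      have hs := Finset.sum_le_sum fun j (_ : j ∈ Finset.univ) =>
        hgood t x (v j) ht hx.1 (hx.2.trans (by nlinarith)) (hv0 j) (hve j) (hvd j) (hne j)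
      rw [Finset.sum_sub_distrib, ← Finset.mul_sum, hmul] at hs
      have := mul_le_mul_of_nonneg_left hsum.le hD'.le
      nlinarith

/-! ### From means of logarithms to integrals over a ray. -/

theorem rootProd_pos {n : ℕ} {w : Fin n → ℂ} {z : ℂ} (h : ∀ j, z ≠ w j) : 0 < rootProd w z :=
  Finset.prod_pos fun j _ => norm_pos_iff.mpr (sub_ne_zero.mpr (h j))

theorem rootProd_eq_zero {n : ℕ} {w : Fin n → ℂ} {z : ℂ} (h : ¬∀ j, z ≠ w j) :
    rootProd w z = 0 := by
  push Not at h
  obtain ⟨j, hj⟩ := h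
  exact Finset.prod_eq_zero (Finset.mem_univ j) (by simp [hj])

theorem rootProd_eq_exp {n : ℕ} {w : Fin n → ℂ} {z : ℂ} (h : ∀ j, z ≠ w j) :
    rootProd w z = Real.exp (∑ j, Real.log ‖z - w j‖) := by
  rw [← Real.log_prod fun j _ => norm_ne_zero_iff.mpr (sub_ne_zero.mpr (h j))]
  exact (Real.exp_log (rootProd_pos h)).symm

/-- Jensen's inequality with exponent 1, the mean of |P| being then bounded by its maximum on the
segment. -/
theorem rootProd_le_exp_mul {n : ℕ} {w : Fin n → ℂ} {z z₀ e : ℂ} {a τ κ M : ℝ} (he : ‖e‖ = 1)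
    (hτ : 0 < τ) (hz : ∀ j, z ≠ w j)
    (h : ∑ j, Real.log ‖z - w j‖ + κ ≤ ∑ j, avgLog z₀ e a τ (w j))
    (hM : ∀ x ∈ Set.Icc a (a + τ), rootProd w (z₀ + (x : ℝ) * e) ≤ M) :
    rootProd w z ≤ Real.exp (-κ) * M := by
  have hM0 : 0 ≤ M := (rootProd_nonneg _ _).trans (hM a ⟨le_rfl, by linarith⟩)
  have h1 := ofReal_mul_exp_le_lintegral_rootProd w he hτ one_pos h
  have h2 : ∫⁻ x in Set.Icc a (a + τ), ENNReal.ofReal (rootProd w (z₀ + (x : ℝ) * e) ^ (1 : ℝ)) ≤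
      ENNReal.ofReal (M * τ) := by
    calc _ ≤ ∫⁻ _ in Set.Icc a (a + τ), ENNReal.ofReal M := by
          refine setLIntegral_mono measurable_const fun x hx => ?_
          rw [Real.rpow_one]
          exact ENNReal.ofReal_le_ofReal (hM x hx)
      _ = _ := by
          rw [setLIntegral_const, Real.volume_Icc, add_sub_cancel_left, ENNReal.ofReal_mul hM0]
  have h3 := (ENNReal.ofReal_le_ofReal_iff (by positivity)).mp (h1.trans h2)
  rw [one_mul, Real.exp_add, ← rootProd_eq_exp hz] at h3
  have h4 : rootProd w z * Real.exp κ ≤ M := by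
    rw [mul_comm] at h3; exact le_of_mul_le_mul_right h3 hτ
  rw [Real.exp_neg, ← div_eq_inv_mul, le_div_iff₀ (Real.exp_pos κ)]
  exact h4

/-- The sum is the imaginary part of the logarithmic derivative, its component normal to the real
axis. -/
theorem sum_im_div_le_norm_recipSum {n : ℕ} (v : Fin n → ℂ) (x : ℝ) :
    ∑ j, (v j).im / ‖(x : ℂ) - v j‖ ^ 2 ≤ ‖recipSum v x‖ := by
  have : (recipSum v x).im = ∑ j, (v j).im / ‖(x : ℂ) - v j‖ ^ 2 := by
    unfold recipSum
    rw [Complex.im_sum]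
    refine Finset.sum_congr rfl fun j _ => ?_
    rw [Complex.inv_im, Complex.normSq_eq_norm_sq]; simp
  rw [← this]
  exact Complex.im_le_norm _

theorem conj_mul_self_of_norm_one {e : ℂ} (he : ‖e‖ = 1) : (starRingEnd ℂ) e * e = 1 := by
  rw [mul_comm, Complex.mul_conj, Complex.normSq_eq_norm_sq, he]; simp

theorem sum_neg_im_div_le_norm_recipSum {n : ℕ} (v : Fin n → ℂ) {e : ℂ} (he : ‖e‖ = 1) (x : ℝ) :
    ∑ j, -(v j * (starRingEnd ℂ) e).im / ‖(x : ℂ) * e - v j‖ ^ 2 ≤ ‖recipSum v (x * e)‖ := by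
  have h1 : ∀ j, (x : ℂ) * e - v j = ((x : ℂ) - v j * (starRingEnd ℂ) e) * e := by
    intro j; linear_combination v j * conj_mul_self_of_norm_one he
  have : (e * recipSum v (x * e)).im = -∑ j, -(v j * (starRingEnd ℂ) e).im / ‖(x : ℂ) * e - v j‖ ^ 2 := by
    unfold recipSum
    rw [Finset.mul_sum, Complex.im_sum, ← Finset.sum_neg_distrib]
    refine Finset.sum_congr rfl fun j _ => ?_
    have he0 : e ≠ 0 := by rintro rfl; simp at he
    rw [h1 j, mul_inv, mul_comm, mul_assoc, inv_mul_cancel₀ he0, mul_one, norm_mul, he, mul_one,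
      Complex.inv_im, Complex.normSq_eq_norm_sq, neg_div, neg_div, neg_neg]
    simp; ring
  have h2 := Complex.abs_im_le_norm (e * recipSum v (x * e))
  rw [this, norm_mul, he, one_mul, abs_neg] at h2
  exact (le_abs_self _).trans h2

/-- After Tonelli, a given x is reached from t in [x/(1 + γ), x]. There the weight is at most (1 +
γ)/(γx), the reciprocal of the length of this interval, so x is counted at most once. Since γ ≤ 1,
only x ≤ 2η occur. -/
theorem lintegral_average_le {γ η : ℝ} (hγ : 0 < γ) (hγ1 : γ ≤ 1) {g : ℝ → ℝ≥0∞}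
    (hg : Measurable g) :
    ∫⁻ t in Set.Ioc 0 η, ENNReal.ofReal (1 / (γ * t)) * ∫⁻ x in Set.Icc t (t + γ * t), g x ≤
      ∫⁻ x in Set.Ioc 0 (2 * η), g x := by
  have hS : MeasurableSet {p : ℝ × ℝ | p.2 ∈ Set.Icc p.1 (p.1 + γ * p.1)} := by
    have : {p : ℝ × ℝ | p.2 ∈ Set.Icc p.1 (p.1 + γ * p.1)} =
        {p | p.1 ≤ p.2} ∩ {p | p.2 ≤ p.1 + γ * p.1} := by ext; simp
    rw [this]
    exact (measurableSet_le measurable_fst measurable_snd).inter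
      (measurableSet_le measurable_snd (by fun_prop))
  set k : ℝ → ℝ → ℝ≥0∞ := fun t x => (Set.Icc t (t + γ * t)).indicator
    (fun x => ENNReal.ofReal (1 / (γ * t)) * g x) x with hk
  have hkm : Measurable (Function.uncurry k) := by
    have : Function.uncurry k = {p : ℝ × ℝ | p.2 ∈ Set.Icc p.1 (p.1 + γ * p.1)}.indicator
        (fun p => ENNReal.ofReal (1 / (γ * p.1)) * g p.2) := by
      ext p; simp [k, Function.uncurry, Set.indicator]
    rw [this]
    exact Measurable.indicator (by fun_prop) hS
  calc _ = ∫⁻ t in Set.Ioc 0 η, ∫⁻ x, k t x := by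
        refine lintegral_congr fun t => ?_
        rw [← lintegral_const_mul _ hg, ← lintegral_indicator measurableSet_Icc]
    _ = ∫⁻ x, ∫⁻ t in Set.Ioc 0 η, k t x := lintegral_lintegral_swap hkm.aemeasurable
    _ ≤ ∫⁻ x, (Set.Ioc 0 (2 * η)).indicator g x := by
        refine lintegral_mono fun x => ?_
        rw [← lintegral_indicator measurableSet_Ioc]
        by_cases hx : x ∈ Set.Ioc 0 (2 * η)
        · rw [Set.indicator_of_mem hx]
          have hx0 : 0 < x := hx.1
          calc _ ≤ ∫⁻ t, (Set.Icc (x / (1 + γ)) x).indicator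
                (fun _ => ENNReal.ofReal ((1 + γ) / (γ * x)) * g x) t := by
                refine lintegral_mono fun t => ?_
                by_cases ht : t ∈ Set.Ioc 0 η ∧ x ∈ Set.Icc t (t + γ * t)
                · have hm : t ∈ Set.Icc (x / (1 + γ)) x :=
                    ⟨by rw [div_le_iff₀ (by linarith)]; linarith [ht.2.2], ht.2.1⟩
                  rw [Set.indicator_of_mem ht.1, Set.indicator_of_mem hm]
                  simp only [k]
                  rw [Set.indicator_of_mem ht.2]
                  refine mul_le_mul_left (ENNReal.ofReal_le_ofReal ?_) _
                  have ht0 : 0 < t := ht.1.1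
                  rw [div_le_div_iff₀ (by positivity) (by positivity)]
                  nlinarith [ht.2.2]
                · rw [not_and_or] at ht
                  rcases ht with ht | ht
                  · rw [Set.indicator_of_notMem ht]; exact zero_le
                  · by_cases h1 : t ∈ Set.Ioc 0 η
                    · rw [Set.indicator_of_mem h1]; simp only [k]
                      rw [Set.indicator_of_notMem ht]; exact zero_le
                    · rw [Set.indicator_of_notMem h1]; exact zero_le
            _ = ENNReal.ofReal ((1 + γ) / (γ * x) * (x - x / (1 + γ))) * g x := by
                rw [lintegral_indicator_const measurableSet_Icc, Real.volume_Icc,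
                  ENNReal.ofReal_mul (by positivity)]
                ring
            _ = g x := by
                have : (1 + γ) / (γ * x) * (x - x / (1 + γ)) = 1 := by field_simp; ring
                rw [this]; simp
        · rw [Set.indicator_of_notMem hx, nonpos_iff_eq_zero]
          have : ∀ t, (Set.Ioc 0 η).indicator (fun t => k t x) t = 0 := by
            intro t
            by_cases h1 : t ∈ Set.Ioc 0 η
            · rw [Set.indicator_of_mem h1]; simp only [k]
              refine Set.indicator_of_notMem (fun h2 => hx ⟨h1.1.trans_le h2.1, ?_⟩) _
              have := h1.1
              nlinarith [h2.2, h1.2]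
            · rw [Set.indicator_of_notMem h1]
          simp [this]
    _ = _ := lintegral_indicator measurableSet_Ioc _

/-- The estimate on one side of a vertex, in coordinates in which the vertex is `0` and the sides
have directions `1` and `e`. -/
theorem exists_ray_lintegral_le {e : ℂ} (he : ‖e‖ = 1) (hB : 0 < e.im) {d τ : ℝ} (hd : 0 < d)
    (hτ : 0 < τ) :
    ∃ c > 0, ∃ η > 0, η ≤ τ ∧ ∀ (n : ℕ) (v : Fin n → ℂ) (q M : ℝ), 0 < q →
      (∀ j, 0 ≤ (v j).im) → (∀ j, (v j * (starRingEnd ℂ) e).im ≤ 0) → (∀ j, ‖v j‖ ≤ d) →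
      (∀ x ∈ Set.Icc 0 (2 * τ), rootProd v (x : ℝ) ≤ M) →
      ∫⁻ x in Set.Ioc 0 η, ENNReal.ofReal (rootProd v (x : ℝ) ^ q) ≤
        (∫⁻ x in Set.Ioc 0 (2 * η) ∩ {x : ℝ | c * n ≤ ‖recipSum v x‖},
            ENNReal.ofReal (rootProd v (x : ℝ) ^ q)) +
          (∫⁻ x in Set.Ioc 0 (2 * η) ∩ {x : ℝ | c * n ≤ ‖recipSum v (x * e)‖},
            ENNReal.ofReal (rootProd v ((x : ℝ) * e) ^ q)) +
          ENNReal.ofReal η * ENNReal.ofReal ((Real.exp (-n) * M) ^ q) := by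
  obtain ⟨c, hc, γ, hγ, hγ1, η', hη', H⟩ := exists_wedge_dichotomy he hB hd hτ
  refine ⟨c, hc, min η' τ, lt_min hη' hτ, min_le_right _ _, ?_⟩
  intro n v q M hq hv0 hve hvd hM
  set η := min η' τ with hη
  have hηpos : 0 < η := lt_min hη' hτ
  set G₁ := {x : ℝ | c * n ≤ ‖recipSum v x‖} with hG₁
  set G₂ := {x : ℝ | c * n ≤ ‖recipSum v (x * e)‖} with hG₂
  have hmG₁ : MeasurableSet G₁ :=
    measurableSet_le measurable_const ((measurable_recipSum v).comp (by fun_prop)).norm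
  have hmG₂ : MeasurableSet G₂ :=
    measurableSet_le measurable_const ((measurable_recipSum v).comp (by fun_prop)).norm
  set f₁ : ℝ → ℝ≥0∞ := fun x => ENNReal.ofReal (rootProd v (x : ℝ) ^ q) with hf₁
  set f₂ : ℝ → ℝ≥0∞ := fun x => ENNReal.ofReal (rootProd v ((x : ℝ) * e) ^ q) with hf₂
  have hmf₁ : Measurable f₁ := by
    have : Continuous fun x : ℝ => rootProd v (x : ℝ) :=
      (continuous_rootProd v).comp (by fun_prop)
    exact (this.measurable.pow_const q).ennreal_ofReal
  have hmf₂ : Measurable f₂ := by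
    have : Continuous fun x : ℝ => rootProd v ((x : ℝ) * e) :=
      (continuous_rootProd v).comp (by fun_prop)
    exact (this.measurable.pow_const q).ennreal_ofReal
  have hM0 : 0 ≤ M := (rootProd_nonneg _ _).trans (hM 0 ⟨le_rfl, by linarith⟩)
  -- The three summands correspond to a good t, to a bad t compared with good points of the second
  -- ray, and to a bad t at which |P| is exponentially small.
  have hpt : ∀ t ∈ Set.Ioc 0 η, f₁ t ≤ G₁.indicator f₁ t +
      ENNReal.ofReal (1 / (γ * t)) * (∫⁻ x in Set.Icc t (t + γ * t), G₂.indicator f₂ x) +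
        ENNReal.ofReal ((Real.exp (-n) * M) ^ q) := by
    rintro t ⟨ht0, ht⟩
    by_cases hz : ∀ j, (t : ℂ) ≠ v j
    · by_cases hG : t ∈ G₁
      · rw [Set.indicator_of_mem hG, add_assoc]; exact le_self_add
      · have hs : ∑ j, (v j).im / ‖(t : ℂ) - v j‖ ^ 2 < c * n :=
          (sum_im_div_le_norm_recipSum v t).trans_lt (not_le.mp hG)
        rcases H n v t ht0 (ht.trans (min_le_left _ _)) hv0 hve hvd hz hs with h | ⟨h, hgood⟩
        · refine le_trans ?_ le_add_self
          refine ENNReal.ofReal_le_ofReal (Real.rpow_le_rpow (rootProd_nonneg _ _) ?_ hq.le)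
          refine rootProd_le_exp_mul (e := 1) (by simp) hτ hz h fun x hx => ?_
          rw [zero_add, mul_one]
          exact hM x ⟨by linarith [hx.1], by linarith [hx.2]⟩
        · refine le_trans ?_ le_self_add
          refine le_trans ?_ le_add_self
          have hpos : 0 < γ * t := by positivity
          have h1 := ofReal_mul_exp_le_lintegral_rootProd v he hpos hq h
          have h2 : ∫⁻ x in Set.Icc t (t + γ * t), ENNReal.ofReal (rootProd v (0 + (x : ℝ) * e) ^ q) =
              ∫⁻ x in Set.Icc t (t + γ * t), G₂.indicator f₂ x := by
            refine setLIntegral_congr_fun measurableSet_Icc fun x hx => ?_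
            have : x ∈ G₂ := (hgood x hx).trans (sum_neg_im_div_le_norm_recipSum v he x)
            simp only [Set.indicator_of_mem this, hf₂, zero_add]
          rw [h2] at h1
          calc f₁ t = ENNReal.ofReal (1 / (γ * t)) *
                ENNReal.ofReal (γ * t * Real.exp (q * ∑ j, Real.log ‖(t : ℂ) - v j‖)) := by
                rw [← ENNReal.ofReal_mul (by positivity), ← mul_assoc, one_div_mul_cancel hpos.ne',
                  one_mul, mul_comm q, Real.exp_mul, ← rootProd_eq_exp hz]
            _ ≤ _ := by gcongr
    · simp [hf₁, rootProd_eq_zero hz, Real.zero_rpow hq.ne']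
  have hmeas1 : Measurable (G₁.indicator f₁) := hmf₁.indicator hmG₁
  calc ∫⁻ x in Set.Ioc 0 η, f₁ x ≤ ∫⁻ t in Set.Ioc 0 η, (G₁.indicator f₁ t +
      ENNReal.ofReal (1 / (γ * t)) * (∫⁻ x in Set.Icc t (t + γ * t), G₂.indicator f₂ x) +
        ENNReal.ofReal ((Real.exp (-n) * M) ^ q)) := setLIntegral_mono' measurableSet_Ioc hpt
    _ = (∫⁻ t in Set.Ioc 0 η, G₁.indicator f₁ t) +
        (∫⁻ t in Set.Ioc 0 η, ENNReal.ofReal (1 / (γ * t)) *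
          ∫⁻ x in Set.Icc t (t + γ * t), G₂.indicator f₂ x) +
        ENNReal.ofReal η * ENNReal.ofReal ((Real.exp (-n) * M) ^ q) := by
        rw [lintegral_add_right _ measurable_const, lintegral_add_left hmeas1, setLIntegral_const,
          Real.volume_Ioc, sub_zero, mul_comm (ENNReal.ofReal ((Real.exp (-n) * M) ^ q))]
    _ ≤ _ := by
        refine add_le_add_left (add_le_add ?_ ?_) _
        · rw [setLIntegral_indicator hmG₁, Set.inter_comm]
          exact lintegral_mono_set (Set.inter_subset_inter_left _
            (Set.Ioc_subset_Ioc_right (by linarith)))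
        · refine (lintegral_average_le hγ hγ1 (hmf₂.indicator hmG₂)).trans_eq ?_
          rw [setLIntegral_indicator hmG₂, Set.inter_comm]

/-! ### Arc length on lines and the local shape of a polygon. -/

theorem isometry_line (b : ℂ) {u : ℂ} (hu : ‖u‖ = 1) : Isometry fun x : ℝ => b + x * u := by
  refine Isometry.of_dist_eq fun x y => ?_
  rw [dist_eq_norm, add_sub_add_left_eq_sub, ← sub_mul, norm_mul, hu, mul_one, ← Complex.ofReal_sub,
    Complex.norm_real, dist_eq_norm]

/-- The parametrisation is an isometric closed embedding, so one-dimensional Hausdorff measure on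
the line is the image of Lebesgue measure, for arbitrary `T` and `f`. -/
theorem setLIntegral_line (b : ℂ) {u : ℂ} (hu : ‖u‖ = 1) (T : Set ℝ) (f : ℂ → ℝ≥0∞) :
    ∫⁻ z in (fun x : ℝ => b + x * u) '' T, f z ∂(Measure.hausdorffMeasure 1) =
      ∫⁻ x in T, f (b + x * u) := by
  have hi := isometry_line b hu
  have hm : MeasurableEmbedding fun x : ℝ => b + x * u :=
    hi.isClosedEmbedding.measurableEmbedding
  have h1 := hi.map_hausdorffMeasure (d := 1) (Or.inl zero_le_one)
  rw [hausdorffMeasure_real] at h1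
  have h2 : (Measure.hausdorffMeasure 1 : Measure ℂ).restrict ((fun x : ℝ => b + x * u) '' T) =
      (volume.restrict T).map (fun x : ℝ => b + x * u) := by
    have h3 := hm.restrict_map volume ((fun x : ℝ => b + x * u) '' T)
    rw [Set.preimage_image_eq _ hi.injective, h1,
      Measure.restrict_restrict_of_subset (Set.image_subset_range _ _)] at h3
    exact h3
  rw [h2, hm.lintegral_map]

/-- The point z is on the edge of a half-plane containing K, and z - t i c̄ leaves that half-plane
for every t > 0. -/
theorem notMem_interior_of_im_nonneg {K : Set ℂ} {b c z : ℂ} (hc : c ≠ 0)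
    (hK : ∀ w ∈ K, 0 ≤ ((w - b) * c).im) (hz : ((z - b) * c).im = 0) : z ∉ interior K := by
  intro hmem
  have hcont : Filter.Tendsto (fun t : ℝ => z - t * (Complex.I * (starRingEnd ℂ) c))
      (nhdsWithin 0 (Set.Ioi 0)) (nhds z) := by
    have : Continuous fun t : ℝ => z - t * (Complex.I * (starRingEnd ℂ) c) := by fun_prop
    simpa using (this.tendsto 0).mono_left nhdsWithin_le_nhds
  have h1 := hcont.eventually (mem_interior_iff_mem_nhds.mp hmem)
  obtain ⟨t, ht, ht0⟩ := (h1.and self_mem_nhdsWithin).exists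
  have h2 := hK _ ht
  have h3 : (z - t * (Complex.I * (starRingEnd ℂ) c) - b) * c =
      (z - b) * c - t * (Complex.I * Complex.normSq c) := by
    rw [← Complex.mul_conj]; ring
  rw [h3, Complex.sub_im, hz] at h2
  have h4 : 0 < Complex.normSq c := Complex.normSq_pos.mpr hc
  have h5 : 0 < t * Complex.normSq c := mul_pos ht0 h4
  simp at h2
  linarith

/-- The local shape of a convex polygonal domain at a boundary point `b` interior to a side of
direction `u`. -/
def FlatAt (K : Set ℂ) (b u : ℂ) (ℓ : ℝ) : Prop :=
  ‖u‖ = 1 ∧ 0 < ℓ ∧ (∀ w ∈ K, 0 ≤ ((w - b) * (starRingEnd ℂ) u).im) ∧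
    b + ℓ * u ∈ K ∧ b - ℓ * u ∈ K

/-- The local shape of a convex polygonal domain at a vertex `b` with adjacent sides of directions
`u` and `u * e`. -/
def WedgeAt (K : Set ℂ) (b u e : ℂ) (ℓ : ℝ) : Prop :=
  ‖u‖ = 1 ∧ ‖e‖ = 1 ∧ 0 < e.im ∧ 0 < ℓ ∧ (∀ w ∈ K, 0 ≤ ((w - b) * (starRingEnd ℂ) u).im) ∧
    (∀ w ∈ K, ((w - b) * (starRingEnd ℂ) u * (starRingEnd ℂ) e).im ≤ 0) ∧
    b + ℓ * u ∈ K ∧ b + ℓ * (u * e) ∈ K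

/-- Hahn–Banach separates b from the interior. A real functional on ℂ is a combination of real and
imaginary parts, so after scaling it becomes Im (w ū), with K to the left of the direction u. -/
theorem exists_supporting_line {K : Set ℂ} (hc : Convex ℝ K) (hi : (interior K).Nonempty) {b : ℂ}
    (hb : b ∉ interior K) :
    ∃ u : ℂ, ‖u‖ = 1 ∧ ∀ w ∈ K, 0 ≤ ((w - b) * (starRingEnd ℂ) u).im := by
  obtain ⟨f, hf⟩ := geometric_hahn_banach_open_point hc.interior isOpen_interior hb
  have hle : ∀ w ∈ K, f w ≤ f b := by
    intro w hw
    have h1 : w ∈ closure (interior K) := by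
      rw [hc.closure_interior_eq_closure_of_nonempty_interior hi]; exact subset_closure hw
    exact closure_minimal (fun z hz => (hf z hz).le) (isClosed_le f.continuous continuous_const) h1
  have hrep : ∀ z : ℂ, f z = z.re * f 1 + z.im * f Complex.I := by
    intro z
    have : z = z.re • (1 : ℂ) + z.im • Complex.I := by simp [Complex.re_add_im]
    conv_lhs => rw [this]
    rw [map_add, map_smul, map_smul, smul_eq_mul, smul_eq_mul]
  set u₀ : ℂ := ⟨-f Complex.I, f 1⟩ with hu₀
  have hu0 : u₀ ≠ 0 := by
    intro h0
    have h1 : f Complex.I = 0 := by simpa [hu₀] using congrArg Complex.re h0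
    have h2 : f 1 = 0 := by simpa [hu₀] using congrArg Complex.im h0
    obtain ⟨z, hz⟩ := hi
    have := hf z hz
    rw [hrep z, hrep b, h1, h2] at this
    simp at this
  refine ⟨(‖u₀‖⁻¹ : ℝ) * u₀, ?_, ?_⟩
  · rw [norm_mul, Complex.norm_real, norm_inv, norm_norm, inv_mul_cancel₀ (norm_ne_zero_iff.mpr hu0)]
  · intro w hw
    have h1 := hle w hw
    rw [hrep w, hrep b] at h1
    have h2 : ((w - b) * (starRingEnd ℂ) ((‖u₀‖⁻¹ : ℝ) * u₀)).im =
        ‖u₀‖⁻¹ * ((b.re * f 1 + b.im * f Complex.I) - (w.re * f 1 + w.im * f Complex.I)) := by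
      simp only [map_mul, Complex.conj_ofReal, Complex.mul_im, Complex.mul_re, Complex.conj_re,
        Complex.conj_im, Complex.ofReal_re, Complex.ofReal_im, Complex.sub_re, Complex.sub_im, hu₀]
      ring
    rw [h2]
    exact mul_nonneg (by positivity) (by linarith)

theorem im_mul_exp_arg (z : ℂ) (θ : ℝ) :
    (z * (starRingEnd ℂ) (Complex.exp (θ * Complex.I))).im = ‖z‖ * Real.sin (z.arg - θ) := by
  have h1 : z = ‖z‖ * Complex.exp (z.arg * Complex.I) := (Complex.norm_mul_exp_arg_mul_I z).symm
  have h2 : (starRingEnd ℂ) (Complex.exp (θ * Complex.I)) = Complex.exp (-θ * Complex.I) := by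
    rw [← Complex.exp_conj]; simp
  have h3 : z * (starRingEnd ℂ) (Complex.exp (θ * Complex.I)) =
      ‖z‖ * Complex.exp ((z.arg - θ : ℝ) * Complex.I) := by
    rw [h2]; conv_lhs => rw [h1]
    rw [mul_assoc, ← Complex.exp_add]
    congr 2; push_cast; ring
  rw [h3, Complex.im_ofReal_mul, Complex.exp_ofReal_mul_I_im]

theorem convex_setOf_im_nonneg (b c : ℂ) : Convex ℝ {w : ℂ | 0 ≤ ((w - b) * c).im} := by
  intro x hx y hy s t hs ht hst
  have h : (s • x + t • y - b) * c = s • ((x - b) * c) + t • ((y - b) * c) := by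
    simp only [Complex.real_smul]
    have : (s : ℂ) + t = 1 := by exact_mod_cast hst
    linear_combination b * c * this
  simp only [Set.mem_ofPred_eq] at hx hy ⊢
  rw [h, Complex.add_im, Complex.smul_im, Complex.smul_im, smul_eq_mul, smul_eq_mul]
  positivity

/-- Seen from b, the generating points other than b have arguments in [0, π] relative to a
supporting direction, and the extreme arguments are the directions of the adjacent sides. Their
difference cannot be 0, as K would lie in a line; difference π is the flat case, anything between is
a vertex. -/
theorem exists_flatAt_or_wedgeAt {K : Set ℂ} (hK : IsConvexPolygonalDomain K) {b : ℂ}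
    (hb : b ∈ frontier K) :
    (∃ u ℓ, FlatAt K b u ℓ) ∨ ∃ u e ℓ, WedgeAt K b u e ℓ := by
  obtain ⟨⟨V, rfl⟩, hi⟩ := hK
  set K := convexHull ℝ (V : Set ℂ) with hKdef
  have hconv : Convex ℝ K := convex_convexHull ℝ _
  have hVK : ∀ v ∈ V, v ∈ K := fun v hv => subset_convexHull ℝ _ hv
  have hhalf : ∀ c : ℂ, (∀ v ∈ V, 0 ≤ ((v - b) * c).im) → ∀ w ∈ K, 0 ≤ ((w - b) * c).im :=
    fun c h => convexHull_min (fun v hv => h v hv) (convex_setOf_im_nonneg b c)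
  obtain ⟨u, hu, hsup⟩ := exists_supporting_line hconv hi hb.2
  have hu0 : u ≠ 0 := by rintro rfl; simp at hu
  have huu := conj_mul_self_of_norm_one hu
  have hne : (V.filter fun v => v ≠ b).Nonempty := by
    by_contra hcon
    rw [Finset.not_nonempty_iff_eq_empty, Finset.filter_eq_empty_iff] at hcon
    obtain ⟨z, hz⟩ := hi
    refine notMem_interior_of_im_nonneg (K := K) (b := b) (c := (starRingEnd ℂ) u * Complex.I)
      (z := z) (by simp [hu0]) (hhalf _ ?_) ?_ hz
    · intro v hv
      simp [not_not.mp (hcon hv)]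
    · have : z ∈ ({b} : Set ℂ) := by
        refine convexHull_min (s := (V : Set ℂ)) (fun v hv => ?_) (convex_singleton b)
          (interior_subset hz)
        exact not_not.mp (hcon hv)
      rw [Set.mem_singleton_iff.mp this]; simp
  set θ : ℂ → ℝ := fun v => ((v - b) * (starRingEnd ℂ) u).arg with hθ
  obtain ⟨v₁, hv₁, hmin⟩ := Finset.exists_min_image _ θ hne
  obtain ⟨v₂, hv₂, hmax⟩ := Finset.exists_max_image _ θ hne
  rw [Finset.mem_filter] at hv₁ hv₂
  have hθ0 : ∀ v ∈ V, 0 ≤ θ v := fun v hv => Complex.arg_nonneg_iff.mpr (hsup v (hVK v hv))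
  have hθπ : ∀ v, θ v ≤ Real.pi := fun v => Complex.arg_le_pi _
  have hrep : ∀ v, b + ‖v - b‖ * (u * Complex.exp (θ v * Complex.I)) = v := by
    intro v
    have h1 : ‖v - b‖ * Complex.exp (θ v * Complex.I) = (v - b) * (starRingEnd ℂ) u := by
      rw [← Complex.norm_mul_exp_arg_mul_I ((v - b) * (starRingEnd ℂ) u), norm_mul,
        RCLike.norm_conj, hu, mul_one]
    linear_combination u * h1 + (v - b) * huu
  have hscale : ∀ {d : ℂ} {L ℓ : ℝ}, 0 ≤ ℓ → ℓ ≤ L → 0 < L → b ∈ K → b + L * d ∈ K → b + ℓ * d ∈ K := by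
    intro d L ℓ h0 h1 hL hbK hLK
    have := hconv hbK hLK (a := 1 - ℓ / L) (b := ℓ / L)
      (sub_nonneg.mpr ((div_le_one hL).mpr h1)) (by positivity) (by ring)
    convert this using 1
    simp only [Complex.real_smul]; push_cast
    have : (L : ℂ) ≠ 0 := by exact_mod_cast hL.ne'
    field_simp; ring
  have hclosed : IsClosed K := (V.finite_toSet.isCompact_convexHull ℝ).isClosed
  have hbK : b ∈ K := hclosed.frontier_subset hb
  have hr₁ : 0 < ‖v₁ - b‖ := norm_pos_iff.mpr (sub_ne_zero.mpr hv₁.2)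
  have hr₂ : 0 < ‖v₂ - b‖ := norm_pos_iff.mpr (sub_ne_zero.mpr hv₂.2)
  set ℓ := min ‖v₁ - b‖ ‖v₂ - b‖ with hℓ
  have hℓ0 : 0 < ℓ := lt_min hr₁ hr₂
  have hend₁ : b + ℓ * (u * Complex.exp (θ v₁ * Complex.I)) ∈ K :=
    hscale hℓ0.le (min_le_left _ _) hr₁ hbK (by rw [hrep]; exact hVK _ hv₁.1)
  have hend₂ : b + ℓ * (u * Complex.exp (θ v₂ * Complex.I)) ∈ K :=
    hscale hℓ0.le (min_le_right _ _) hr₂ hbK (by rw [hrep]; exact hVK _ hv₂.1)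
  have hrange : ∀ v ∈ V, v ≠ b → θ v₁ ≤ θ v ∧ θ v ≤ θ v₂ := fun v hv hvb =>
    ⟨hmin v (Finset.mem_filter.mpr ⟨hv, hvb⟩), hmax v (Finset.mem_filter.mpr ⟨hv, hvb⟩)⟩
  have hlow : ∀ w ∈ K, 0 ≤ ((w - b) * ((starRingEnd ℂ) u *
      (starRingEnd ℂ) (Complex.exp (θ v₁ * Complex.I)))).im := by
    refine hhalf _ fun v hv => ?_
    rw [← mul_assoc, im_mul_exp_arg]
    by_cases hvb : v = b
    · simp [hvb]
    · exact mul_nonneg (norm_nonneg _) (Real.sin_nonneg_of_nonneg_of_le_pi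
        (sub_nonneg.mpr (hrange v hv hvb).1) (by linarith [hθπ v, hθ0 v₁ hv₁.1]))
  have hhigh : ∀ w ∈ K, 0 ≤ ((w - b) * -((starRingEnd ℂ) u *
      (starRingEnd ℂ) (Complex.exp (θ v₂ * Complex.I)))).im := by
    refine hhalf _ fun v hv => ?_
    rw [mul_neg, Complex.neg_im, ← mul_assoc, im_mul_exp_arg]
    by_cases hvb : v = b
    · simp [hvb]
    · rw [neg_nonneg]
      exact mul_nonpos_of_nonneg_of_nonpos (norm_nonneg _)
        (Real.sin_nonpos_of_nonpos_of_neg_pi_le (sub_nonpos.mpr (hrange v hv hvb).2)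
          (by linarith [hθπ v₂, hθ0 v hv]))
  rcases (sub_nonneg.mpr (hmin v₂ (Finset.mem_filter.mpr hv₂))).eq_or_lt with heq | hlt
  · exfalso
    have heq' : θ v₂ = θ v₁ := by linarith
    obtain ⟨z, hz⟩ := hi
    refine notMem_interior_of_im_nonneg ?_ hlow ?_ hz
    · simp [hu0, ← Complex.exp_conj]
    · have h1 := hhigh z (interior_subset hz)
      rw [heq', mul_neg, Complex.neg_im, neg_nonneg] at h1
      exact le_antisymm h1 (hlow z (interior_subset hz))
  rcases (show θ v₂ - θ v₁ ≤ Real.pi by linarith [hθπ v₂, hθ0 v₁ hv₁.1]).eq_or_lt with hπ | hπ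
  · left
    have h1 : θ v₁ = 0 := by linarith [hθπ v₂, hθ0 v₁ hv₁.1]
    have h2 : θ v₂ = Real.pi := by linarith
    refine ⟨u, ℓ, hu, hℓ0, hsup, ?_, ?_⟩
    · simpa [h1] using hend₁
    · rw [h2, Complex.exp_pi_mul_I] at hend₂
      simpa [sub_eq_add_neg] using hend₂
  · right
    refine ⟨u * Complex.exp (θ v₁ * Complex.I), Complex.exp ((θ v₂ - θ v₁ : ℝ) * Complex.I), ℓ,
      ?_, Complex.norm_exp_ofReal_mul_I _, ?_, hℓ0, ?_, ?_, hend₁, ?_⟩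
    · rw [norm_mul, hu, Complex.norm_exp_ofReal_mul_I, one_mul]
    · rw [Complex.exp_ofReal_mul_I_im]; exact Real.sin_pos_of_pos_of_lt_pi hlt hπ
    · intro w hw; rw [map_mul]; exact hlow w hw
    · intro w hw
      have h1 := hhigh w hw
      rw [mul_neg, Complex.neg_im, neg_nonneg] at h1
      have h2 : (starRingEnd ℂ) (u * Complex.exp (θ v₁ * Complex.I)) *
          (starRingEnd ℂ) (Complex.exp ((θ v₂ - θ v₁ : ℝ) * Complex.I)) =
          (starRingEnd ℂ) u * (starRingEnd ℂ) (Complex.exp (θ v₂ * Complex.I)) := by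
        rw [← map_mul, ← map_mul, mul_assoc, ← Complex.exp_add]
        congr 3; push_cast; ring
      rw [mul_assoc, h2]; exact h1
    · have h2 : u * Complex.exp (θ v₁ * Complex.I) * Complex.exp ((θ v₂ - θ v₁ : ℝ) * Complex.I) =
          u * Complex.exp (θ v₂ * Complex.I) := by
        rw [mul_assoc, ← Complex.exp_add]
        congr 2; push_cast; ring
      rw [h2]; exact hend₂

/-! ### Local estimates along the boundary. -/

/-- The `L^q` norm of a monic polynomial with zeros in `K` on `S ∩ ∂K` is controlled by its norm on
the part of the boundary where the logarithmic derivative is of order `n`, up to an exponentially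
small part of its maximum. -/
def LocalEstimate (K S : Set ℂ) : Prop :=
  ∃ c > 0, ∃ κ > 0, ∃ C : ℝ, 0 ≤ C ∧ ∀ (q : ℝ) (n : ℕ) (w : Fin n → ℂ) (M : ℝ), 0 < q → 0 ≤ M →
    (∀ j, w j ∈ K) → (∀ z ∈ K, rootProd w z ≤ M) →
    ∫⁻ z in S ∩ frontier K, ENNReal.ofReal (rootProd w z ^ q) ∂(Measure.hausdorffMeasure 1) ≤
      ENNReal.ofReal C * ((∫⁻ z in frontier K ∩ {z | c * n ≤ ‖recipSum w z‖},
        ENNReal.ofReal (rootProd w z ^ q) ∂(Measure.hausdorffMeasure 1)) +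
        ENNReal.ofReal ((Real.exp (-(κ * n)) * M) ^ q))

theorem rootProd_congr {n : ℕ} {w v : Fin n → ℂ} {z ζ : ℂ} (h : ∀ j, ‖z - w j‖ = ‖ζ - v j‖) :
    rootProd w z = rootProd v ζ :=
  Finset.prod_congr rfl fun j _ => h j

theorem norm_recipSum_congr {n : ℕ} {w v : Fin n → ℂ} {z ζ a : ℂ} (ha : ‖a‖ = 1)
    (h : ∀ j, z - w j = a * (ζ - v j)) : ‖recipSum w z‖ = ‖recipSum v ζ‖ := by
  have : recipSum w z = a⁻¹ * recipSum v ζ := by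
    unfold recipSum
    rw [Finset.mul_sum]
    exact Finset.sum_congr rfl fun j _ => by rw [h j, mul_inv]
  rw [this, norm_mul, norm_inv, ha, inv_one, one_mul]

theorem norm_recipSum_congr_conj {n : ℕ} {w v : Fin n → ℂ} {z ζ a : ℂ} (ha : ‖a‖ = 1)
    (h : ∀ j, z - w j = a * (starRingEnd ℂ) (ζ - v j)) : ‖recipSum w z‖ = ‖recipSum v ζ‖ := by
  have : recipSum w z = a⁻¹ * (starRingEnd ℂ) (recipSum v ζ) := by
    unfold recipSum
    rw [map_sum, Finset.mul_sum]
    exact Finset.sum_congr rfl fun j _ => by rw [h j, mul_inv, map_inv₀]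
  rw [this, norm_mul, norm_inv, ha, inv_one, one_mul, RCLike.norm_conj]

theorem Convex.three_mem {s : Set ℂ} (hs : Convex ℝ s) {x y z : ℂ} (hx : x ∈ s) (hy : y ∈ s)
    (hz : z ∈ s) {a b c : ℝ} (ha : 0 ≤ a) (hb : 0 ≤ b) (hc : 0 ≤ c) (h : a + b + c = 1) :
    (a : ℂ) * x + b * y + c * z ∈ s := by
  have := hs.sum_mem (t := Finset.univ) (w := ![a, b, c]) (z := ![x, y, z]) ?_ ?_ ?_
  · simpa [Fin.sum_univ_three] using this
  · intro i _; fin_cases i <;> simpa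
  · simpa [Fin.sum_univ_three] using h
  · intro i _; fin_cases i <;> simpa

theorem sub_coord {b u : ℂ} (hu : ‖u‖ = 1) (w ζ : ℂ) :
    b + ζ * u - w = u * (ζ - (w - b) * (starRingEnd ℂ) u) := by
  linear_combination (w - b) * conj_mul_self_of_norm_one hu

theorem rootProd_coord {n : ℕ} (w : Fin n → ℂ) {b u : ℂ} (hu : ‖u‖ = 1) (ζ : ℂ) :
    rootProd w (b + ζ * u) = rootProd (fun j => (w j - b) * (starRingEnd ℂ) u) ζ :=
  rootProd_congr fun j => by rw [sub_coord hu, norm_mul, hu, one_mul]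

theorem norm_recipSum_coord {n : ℕ} (w : Fin n → ℂ) {b u : ℂ} (hu : ‖u‖ = 1) (ζ : ℂ) :
    ‖recipSum w (b + ζ * u)‖ = ‖recipSum (fun j => (w j - b) * (starRingEnd ℂ) u) ζ‖ :=
  norm_recipSum_congr hu fun j => sub_coord hu (w j) ζ

theorem line_mem_frontier {K : Set ℂ} (hconv : Convex ℝ K) {b u c : ℂ} {L : ℝ} (hL : 0 < L)
    (hbK : b ∈ K) (hLK : b + L * u ∈ K) (hc : c ≠ 0) (hK : ∀ w ∈ K, 0 ≤ ((w - b) * c).im)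
    (huc : (u * c).im = 0) {x : ℝ} (h0 : 0 ≤ x) (hx : x ≤ L) : b + x * u ∈ frontier K := by
  refine ⟨subset_closure ?_, notMem_interior_of_im_nonneg hc hK ?_⟩
  · have := hconv hbK hLK (a := 1 - x / L) (b := x / L)
      (sub_nonneg.mpr ((div_le_one hL).mpr hx)) (by positivity) (by ring)
    convert this using 1
    simp only [Complex.real_smul]; push_cast
    have : (L : ℂ) ≠ 0 := by exact_mod_cast hL.ne'
    field_simp; ring
  · rw [add_sub_cancel_left, mul_assoc, Complex.im_ofReal_mul, huc, mul_zero]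

namespace FlatAt

variable {K : Set ℂ} {b u : ℂ} {ℓ : ℝ}

/-- The rectangle is cut out of the triangle with vertices b ± ℓu and an interior point k: height y
requires weight y / Im v on k, and `h₀` is so small that this weight shifts the point sideways by at
most ℓ/4. -/
theorem exists_rectangle (h : FlatAt K b u ℓ) (hconv : Convex ℝ K) (hi : (interior K).Nonempty) :
    ∃ ρ > 0, ∃ h₀ > 0, ρ ≤ ℓ / 2 ∧ ∀ x y : ℝ, |x| ≤ ρ → 0 ≤ y → y ≤ 2 * h₀ →
      b + (x + y * Complex.I) * u ∈ K := by
  obtain ⟨hu, hℓ, hK, h1, h2⟩ := h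
  have hu0 : u ≠ 0 := by rintro rfl; simp at hu
  obtain ⟨k, hk⟩ := hi
  set v := (k - b) * (starRingEnd ℂ) u with hv
  have hβ : 0 < v.im := by
    refine lt_of_le_of_ne (hK k (interior_subset hk)) fun h0 => ?_
    exact notMem_interior_of_im_nonneg (by simp [hu0]) hK h0.symm hk
  have hkv : k = b + v * u := by
    rw [hv]; linear_combination -(k - b) * conj_mul_self_of_norm_one hu
  set lam := min (1 / 2) (ℓ / (4 * (|v.re| + 1))) with hlam
  have hlam0 : 0 < lam := by positivity
  refine ⟨ℓ / 4, by positivity, v.im * lam / 2, by positivity, by linarith, ?_⟩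
  intro x y hx hy hy2
  set l := y / v.im with hl
  have hl0 : 0 ≤ l := by positivity
  have hll : l ≤ lam := by rw [hl, div_le_iff₀ hβ]; linarith
  have hl2 : l ≤ 1 / 2 := hll.trans (min_le_left _ _)
  have hl3 : |l * v.re| ≤ ℓ / 4 := by
    rw [abs_mul, abs_of_nonneg hl0]
    have h3 : l * (4 * (|v.re| + 1)) ≤ ℓ := by
      have := hll.trans (min_le_right _ _)
      rwa [le_div_iff₀ (by positivity)] at this
    nlinarith [abs_nonneg v.re]
  have hlow := neg_abs_le (l * v.re)
  have hup := le_abs_self (l * v.re)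
  have hx1 := (abs_le.mp hx).1
  have hx2 := (abs_le.mp hx).2
  have hq : |(x - l * v.re) / ℓ| ≤ 1 / 2 := by
    rw [abs_div, abs_of_pos hℓ, div_le_iff₀ hℓ, abs_le]
    constructor <;> linarith
  have hq1 := (abs_le.mp hq).1
  have hq2 := (abs_le.mp hq).2
  have hmem := hconv.three_mem (interior_subset hk) h1 h2 (a := l)
    (b := ((1 - l) + (x - l * v.re) / ℓ) / 2) (c := ((1 - l) - (x - l * v.re) / ℓ) / 2) hl0
    (by linarith) (by linarith) (by ring)
  convert hmem using 1
  have hy' : (y : ℂ) = l * v.im := by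
    rw [hl]; push_cast
    have : (v.im : ℂ) ≠ 0 := by exact_mod_cast hβ.ne'
    field_simp
  have hkv' : k = b + ((v.re : ℂ) + v.im * Complex.I) * u := by rw [Complex.re_add_im]; exact hkv
  have hℓ' : (ℓ : ℂ) ≠ 0 := by exact_mod_cast hℓ.ne'
  rw [hkv', hy']
  push_cast
  field_simp
  ring

/-- A point of K near b but off the line lies in the open part of the rectangle, hence in the
interior of K. -/
theorem frontier_subset (h : FlatAt K b u ℓ) (hcl : IsClosed K) {ρ h₀ : ℝ}
    (hrect : ∀ x y : ℝ, |x| ≤ ρ → 0 ≤ y → y ≤ 2 * h₀ → b + (x + y * Complex.I) * u ∈ K) :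
    Metric.ball b (min ρ (2 * h₀)) ∩ frontier K ⊆ (fun x : ℝ => b + x * u) '' {x | |x| < ρ} := by
  obtain ⟨hu, hℓ, hK, -, -⟩ := h
  rintro z ⟨hzb, hzf⟩
  rw [Metric.mem_ball, dist_eq_norm] at hzb
  set ζ := (z - b) * (starRingEnd ℂ) u with hζ
  have hzζ : z = b + ζ * u := by
    rw [hζ]; linear_combination -(z - b) * conj_mul_self_of_norm_one hu
  have hnζ : ‖ζ‖ = ‖z - b‖ := by rw [hζ, norm_mul, RCLike.norm_conj, hu, mul_one]
  have hre : |ζ.re| < ρ :=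
    (Complex.abs_re_le_norm ζ).trans_lt (by rw [hnζ]; exact hzb.trans_le (min_le_left _ _))
  have him0 : 0 ≤ ζ.im := hK z (hcl.frontier_subset hzf)
  have him : ζ.im < 2 * h₀ :=
    (Complex.im_le_norm ζ).trans_lt (by rw [hnζ]; exact hzb.trans_le (min_le_right _ _))
  have him' : ζ.im = 0 := by
    by_contra hne
    have hpos : 0 < ζ.im := lt_of_le_of_ne him0 (Ne.symm hne)
    refine hzf.2 (mem_interior.mpr ⟨{y : ℂ | |((y - b) * (starRingEnd ℂ) u).re| < ρ} ∩
      ({y | 0 < ((y - b) * (starRingEnd ℂ) u).im} ∩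
        {y | ((y - b) * (starRingEnd ℂ) u).im < 2 * h₀}), ?_, ?_, hre, hpos, him⟩)
    · rintro y ⟨hy1, hy2, hy3⟩
      have := hrect _ _ (le_of_lt hy1) (le_of_lt hy2) (le_of_lt hy3)
      rw [Complex.re_add_im] at this
      convert this using 1
      linear_combination -(y - b) * conj_mul_self_of_norm_one hu
    · refine (isOpen_lt (by fun_prop) continuous_const).inter
        ((isOpen_lt continuous_const (by fun_prop)).inter (isOpen_lt (by fun_prop) continuous_const))
  have hζr : (ζ.re : ℂ) = ζ := Complex.ext (by simp) (by simp [him'])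
  exact ⟨ζ.re, hre, by simp only [hζr]; exact hzζ.symm⟩

/-- A boundary point near b is either good or, by `exists_flat_gain`, has |P| ≤ e^(-κn) M; the test
segment, at heights h₀ to 2h₀, stays in the rectangle, where M is a bound. -/
theorem exists_localEstimate (h : FlatAt K b u ℓ) (hconv : Convex ℝ K) (hcl : IsClosed K)
    (hbd : Bornology.IsBounded K) (hi : (interior K).Nonempty) :
    ∃ U ∈ nhds b, LocalEstimate K U := by
  obtain ⟨ρ, hρ, h₀, hh, -, hrect⟩ := h.exists_rectangle hconv hi
  obtain ⟨hu, hℓ, hK, h1, h2⟩ := id h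
  obtain ⟨d, hd, hdK⟩ : ∃ d > 0, ∀ w ∈ K, ‖w - b‖ ≤ d := by
    obtain ⟨d, hd⟩ := hbd.subset_closedBall b
    exact ⟨max d 1, by positivity, fun w hw => by
      simpa [dist_eq_norm] using (hd hw).trans (le_max_left d 1)⟩
  obtain ⟨c, hc, κ, hκ, H⟩ := exists_flat_gain hh (show 0 < d + ρ by positivity)
  refine ⟨Metric.ball b (min ρ (2 * h₀)), Metric.ball_mem_nhds _ (by positivity), c, hc, κ, hκ,
    1 + 2 * ρ, by positivity, ?_⟩
  intro q n w M hq hM0 hw hM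
  set v : Fin n → ℂ := fun j => (w j - b) * (starRingEnd ℂ) u with hv
  set T : Set ℝ := {x | |x| ≤ ρ ∧ rootProd w (b + x * u) ≤ Real.exp (-(κ * n)) * M} with hT
  set G := frontier K ∩ {z | c * n ≤ ‖recipSum w z‖} with hG
  have hsub : Metric.ball b (min ρ (2 * h₀)) ∩ frontier K ⊆ G ∪ (fun x : ℝ => b + x * u) '' T := by
    intro z hz
    obtain ⟨x₀, hx₀, rfl⟩ := h.frontier_subset hcl hrect hz
    simp only [Set.mem_ofPred_eq] at hx₀
    have hzf := hz.2
    by_cases hg : c * n ≤ ‖recipSum w (b + x₀ * u)‖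
    · exact Or.inl ⟨hzf, hg⟩
    · refine Or.inr ⟨x₀, ⟨hx₀.le, ?_⟩, rfl⟩
      have hroot : rootProd w (b + x₀ * u) = rootProd v x₀ := rootProd_coord w hu _
      rw [hroot]
      by_cases hz : ∀ j, (x₀ : ℂ) ≠ v j
      · have hs : ∑ j, (v j).im / ‖(x₀ : ℂ) - v j‖ ^ 2 < c * n := by
          refine (sum_im_div_le_norm_recipSum v x₀).trans_lt ?_
          rw [← norm_recipSum_coord w hu]
          exact not_le.mp hg
        refine rootProd_le_exp_mul (by simp) hh hz (H n v x₀ (fun j => hK _ (hw j)) ?_ hz hs) ?_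
        · intro j
          refine (norm_sub_le _ _).trans ?_
          have e1 : ‖v j‖ ≤ d := by
            rw [hv]; simp only [norm_mul, RCLike.norm_conj, hu, mul_one]; exact hdK _ (hw j)
          have e2 : ‖(x₀ : ℂ)‖ ≤ ρ := by
            rw [Complex.norm_real]; exact hx₀.le
          linarith
        · intro x hx
          rw [← rootProd_coord w hu]
          exact hM _ (hrect _ _ hx₀.le (by linarith [hx.1]) (by linarith [hx.2]))
      · rw [rootProd_eq_zero hz]; positivity
  have hTint : ∫⁻ z in (fun x : ℝ => b + x * u) '' T, ENNReal.ofReal (rootProd w z ^ q)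
      ∂(Measure.hausdorffMeasure 1) ≤
      ENNReal.ofReal (2 * ρ) * ENNReal.ofReal ((Real.exp (-(κ * n)) * M) ^ q) := by
    rw [setLIntegral_line b hu]
    calc _ ≤ ∫⁻ _ in T, ENNReal.ofReal ((Real.exp (-(κ * n)) * M) ^ q) :=
          setLIntegral_mono measurable_const fun x hx => ENNReal.ofReal_le_ofReal
            (Real.rpow_le_rpow (rootProd_nonneg _ _) hx.2 hq.le)
      _ ≤ ∫⁻ _ in Set.Icc (-ρ) ρ, ENNReal.ofReal ((Real.exp (-(κ * n)) * M) ^ q) :=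
          lintegral_mono_set fun x hx => abs_le.mp hx.1
      _ = _ := by
          rw [setLIntegral_const, Real.volume_Icc, mul_comm]; congr 2; ring
  refine (lintegral_mono_set hsub).trans ((lintegral_union_le _ _ _).trans ?_)
  rw [mul_add]
  refine add_le_add ?_ (hTint.trans ?_)
  · exact le_mul_of_one_le_left zero_le (ENNReal.one_le_ofReal.mpr (by linarith))
  · exact mul_le_mul_left (ENNReal.ofReal_le_ofReal (by linarith)) _

end FlatAt

namespace WedgeAt

variable {K : Set ℂ} {b u e : ℂ} {ℓ : ℝ}

theorem side_mem_frontier (h : WedgeAt K b u e ℓ) (hconv : Convex ℝ K) (hbK : b ∈ K) {x : ℝ}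
    (h0 : 0 ≤ x) (hx : x ≤ ℓ) : b + x * u ∈ frontier K ∧ b + x * (u * e) ∈ frontier K := by
  obtain ⟨hu, he, hB, hℓ, hK, hK', h1, h2⟩ := h
  have hu0 : u ≠ 0 := by rintro rfl; simp at hu
  have he0 : e ≠ 0 := by rintro rfl; simp at he
  have huu := conj_mul_self_of_norm_one hu
  have hee := conj_mul_self_of_norm_one he
  refine ⟨line_mem_frontier hconv hℓ hbK h1 (c := (starRingEnd ℂ) u) (by simp [hu0]) hK ?_ h0 hx,
    line_mem_frontier hconv hℓ hbK h2 (c := -((starRingEnd ℂ) u * (starRingEnd ℂ) e))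
      (by simp [hu0, he0]) ?_ ?_ h0 hx⟩
  · rw [mul_comm, huu, Complex.one_im]
  · intro w hw
    have := hK' w hw
    rw [mul_neg, Complex.neg_im, ← mul_assoc]; linarith
  · have : u * e * -((starRingEnd ℂ) u * (starRingEnd ℂ) e) = -1 := by
      linear_combination -huu * (starRingEnd ℂ e * e) - hee
    rw [this]; simp

/-- In oblique coordinates X, Y along the two sides, a point near b with X, Y > 0 belongs to the
open triangle X + Y < ℓ, which K contains by convexity; so a frontier point there has X = 0 or Y =
0. -/
theorem frontier_subset (h : WedgeAt K b u e ℓ) (hconv : Convex ℝ K) (hcl : IsClosed K)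
    (hbK : b ∈ K) {η : ℝ} (hη : 0 < η) :
    ∃ ρ > 0, Metric.ball b ρ ∩ frontier K ⊆ {b} ∪ ((fun x : ℝ => b + x * u) '' Set.Ioc 0 η ∪
      (fun x : ℝ => b + x * (u * e)) '' Set.Ioc 0 η) := by
  obtain ⟨hu, he, hB, hℓ, hK, hK', h1, h2⟩ := h
  have huu := conj_mul_self_of_norm_one hu
  refine ⟨min η (ℓ * e.im / 2), by positivity, ?_⟩
  rintro z ⟨hzb, hzf⟩
  rw [Metric.mem_ball, dist_eq_norm] at hzb
  have hzK := hcl.frontier_subset hzf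
  set X : ℂ → ℝ := fun y => -((y - b) * (starRingEnd ℂ) u * (starRingEnd ℂ) e).im / e.im with hX
  set Y : ℂ → ℝ := fun y => ((y - b) * (starRingEnd ℂ) u).im / e.im with hY
  have hXY : ∀ y, y = b + X y * u + Y y * (u * e) := by
    intro y
    set ζ := (y - b) * (starRingEnd ℂ) u with hζ
    have hyζ : y = b + ζ * u := by
      rw [hζ]; linear_combination -(y - b) * huu
    have : ζ = X y + Y y * e := by
      have hXζ : X y = -(ζ * (starRingEnd ℂ) e).im / e.im := rfl
      have hYζ : Y y = ζ.im / e.im := rfl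
      rw [hXζ, hYζ]
      apply Complex.ext
      · simp; field_simp; ring
      · simp; field_simp
    calc y = b + ζ * u := hyζ
      _ = b + (X y + Y y * e) * u := by rw [← this]
      _ = _ := by ring
  have hX0 : 0 ≤ X z := div_nonneg (by linarith [hK' z hzK]) hB.le
  have hY0 : 0 ≤ Y z := div_nonneg (hK z hzK) hB.le
  have hXn : X z ≤ ‖z - b‖ / e.im := by
    refine div_le_div_of_nonneg_right ?_ hB.le
    have := Complex.abs_im_le_norm ((z - b) * (starRingEnd ℂ) u * (starRingEnd ℂ) e)
    rw [norm_mul, norm_mul, RCLike.norm_conj, RCLike.norm_conj, hu, he, mul_one, mul_one] at this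
    linarith [neg_abs_le ((z - b) * (starRingEnd ℂ) u * (starRingEnd ℂ) e).im]
  have hYn : Y z ≤ ‖z - b‖ / e.im := by
    refine div_le_div_of_nonneg_right ?_ hB.le
    have := Complex.abs_im_le_norm ((z - b) * (starRingEnd ℂ) u)
    rw [norm_mul, RCLike.norm_conj, hu, mul_one] at this
    linarith [le_abs_self ((z - b) * (starRingEnd ℂ) u).im]
  have hsum : X z + Y z < ℓ := by
    have : ‖z - b‖ / e.im < ℓ / 2 := by
      rw [div_lt_iff₀ hB]; linarith [hzb.trans_le (min_le_right _ _)]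
    linarith
  have hXu : ∀ a : ℝ, 0 < a → ∀ d : ℂ, ‖d‖ = 1 → z = b + a * d → a ≤ η := by
    intro a ha d hd hz
    have : ‖z - b‖ = a := by
      rw [hz, add_sub_cancel_left, norm_mul, hd, mul_one, Complex.norm_real, Real.norm_eq_abs,
        abs_of_pos ha]
    linarith [hzb.trans_le (min_le_left _ _)]
  rcases hX0.eq_or_lt with hx0 | hx0
  · have hz := hXY z
    rw [← hx0, Complex.ofReal_zero, zero_mul, add_zero] at hz
    rcases hY0.eq_or_lt with hy0 | hy0
    · left; rw [hz, ← hy0]; simp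
    · exact Or.inr (Or.inr ⟨Y z, ⟨hy0, hXu _ hy0 _ (by rw [norm_mul, hu, he, one_mul]) hz⟩, hz.symm⟩)
  · rcases hY0.eq_or_lt with hy0 | hy0
    · have hz := hXY z
      rw [← hy0, Complex.ofReal_zero, zero_mul, add_zero] at hz
      exact Or.inr (Or.inl ⟨X z, ⟨hx0, hXu _ hx0 _ hu hz⟩, hz.symm⟩)
    · exfalso
      have hXc : Continuous X := by simp only [hX]; fun_prop
      have hYc : Continuous Y := by simp only [hY]; fun_prop
      refine hzf.2 (mem_interior.mpr ⟨{y | 0 < X y} ∩ ({y | 0 < Y y} ∩ {y | X y + Y y < ℓ}), ?_,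
        (isOpen_lt continuous_const hXc).inter ((isOpen_lt continuous_const hYc).inter
          (isOpen_lt (hXc.add hYc) continuous_const)), hx0, hy0, hsum⟩)
      rintro y ⟨hy1, hy2, hy3⟩
      simp only [Set.mem_ofPred_eq] at hy1 hy2 hy3
      have hmem := hconv.three_mem hbK h1 h2 (a := 1 - (X y + Y y) / ℓ) (b := X y / ℓ)
        (c := Y y / ℓ) (sub_nonneg.mpr ((div_le_one hℓ).mpr hy3.le)) (by positivity) (by positivity)
        (by ring)
      convert hmem using 1
      have hℓ' : (ℓ : ℂ) ≠ 0 := by exact_mod_cast hℓ.ne'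
      conv_lhs => rw [hXY y]
      push_cast
      field_simp
      ring

/-- The first side is `exists_ray_lintegral_le`. The reflection v ↦ v̄ e in the bisector exchanges
the rays along 1 and e, so the same lemma serves the second side. Taking τ = ℓ/2 keeps all segments
involved on the sides. -/
theorem exists_localEstimate (h : WedgeAt K b u e ℓ) (hconv : Convex ℝ K) (hcl : IsClosed K)
    (hbd : Bornology.IsBounded K) (hbK : b ∈ K) :
    ∃ U ∈ nhds b, LocalEstimate K U := by
  have hside := fun x : ℝ => h.side_mem_frontier hconv hbK (x := x)
  obtain ⟨hu, he, hB, hℓ, hK, hK', h1, h2⟩ := id h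
  have hue : ‖u * e‖ = 1 := by rw [norm_mul, hu, he, one_mul]
  have hee := conj_mul_self_of_norm_one he
  obtain ⟨d, hd, hdK⟩ : ∃ d > 0, ∀ w ∈ K, ‖w - b‖ ≤ d := by
    obtain ⟨d, hd⟩ := hbd.subset_closedBall b
    exact ⟨max d 1, by positivity, fun w hw => by
      simpa [dist_eq_norm] using (hd hw).trans (le_max_left d 1)⟩
  obtain ⟨c, hc, η, hη, hητ, H⟩ := exists_ray_lintegral_le he hB hd (half_pos hℓ)
  obtain ⟨ρ, hρ, hsub⟩ := h.frontier_subset hconv hcl hbK hη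
  refine ⟨Metric.ball b ρ, Metric.ball_mem_nhds _ hρ, c, hc, 1, one_pos, 4 + 2 * η, by positivity, ?_⟩
  intro q n w M hq hM0 hw hM
  set v : Fin n → ℂ := fun j => (w j - b) * (starRingEnd ℂ) u with hv
  set v' : Fin n → ℂ := fun j => (starRingEnd ℂ) (v j) * e with hv'
  set F : ℂ → ℝ≥0∞ := fun z => ENNReal.ofReal (rootProd w z ^ q) with hF
  set J := ∫⁻ z in frontier K ∩ {z | c * n ≤ ‖recipSum w z‖}, F z ∂(Measure.hausdorffMeasure 1)
    with hJ
  set E := ENNReal.ofReal ((Real.exp (-n) * M) ^ q) with hE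
  have hd1 : ∀ (x : ℝ) j, (x : ℂ) - v' j = e * (starRingEnd ℂ) ((x : ℂ) * e - v j) := by
    intro x j; simp only [hv', map_sub, map_mul, Complex.conj_ofReal]
    linear_combination -(x : ℂ) * hee
  have hd2 : ∀ (x : ℝ) j, (x : ℂ) * e - v' j = e * (starRingEnd ℂ) ((x : ℂ) - v j) := by
    intro x j; simp only [hv', map_sub, Complex.conj_ofReal]; ring
  have hnv : ∀ j, ‖v j‖ ≤ d := fun j => by
    simp only [hv, norm_mul, RCLike.norm_conj, hu, mul_one]; exact hdK _ (hw j)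
  have hp1 : ∀ x : ℝ, rootProd w (b + x * u) = rootProd v x := fun x => rootProd_coord w hu x
  have hp2 : ∀ x : ℝ, rootProd w (b + x * (u * e)) = rootProd v (x * e) := fun x => by
    rw [← rootProd_coord w hu]; congr 1; ring
  have hr1 : ∀ x : ℝ, ‖recipSum w (b + x * u)‖ = ‖recipSum v x‖ := fun x =>
    norm_recipSum_coord w hu x
  have hr2 : ∀ x : ℝ, ‖recipSum w (b + x * (u * e))‖ = ‖recipSum v (x * e)‖ := fun x => by
    rw [← norm_recipSum_coord w hu]; congr 2; ring
  have hp1' : ∀ x : ℝ, rootProd v' x = rootProd v (x * e) := fun x =>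
    rootProd_congr fun j => by rw [hd1, norm_mul, he, one_mul, RCLike.norm_conj]
  have hp2' : ∀ x : ℝ, rootProd v' (x * e) = rootProd v x := fun x =>
    rootProd_congr fun j => by rw [hd2, norm_mul, he, one_mul, RCLike.norm_conj]
  have hr1' : ∀ x : ℝ, ‖recipSum v' x‖ = ‖recipSum v (x * e)‖ := fun x =>
    norm_recipSum_congr_conj he (hd1 x)
  have hr2' : ∀ x : ℝ, ‖recipSum v' (x * e)‖ = ‖recipSum v x‖ := fun x =>
    norm_recipSum_congr_conj he (hd2 x)
  have hJ1 : ∫⁻ x in Set.Ioc 0 (2 * η) ∩ {x : ℝ | c * n ≤ ‖recipSum v x‖},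
      ENNReal.ofReal (rootProd v (x : ℝ) ^ q) ≤ J := by
    have := setLIntegral_line b hu (Set.Ioc 0 (2 * η) ∩ {x : ℝ | c * n ≤ ‖recipSum v x‖}) F
    simp only [hF, hp1] at this
    rw [← this]
    refine lintegral_mono_set ?_
    rintro _ ⟨x, ⟨hx1, hx2⟩, rfl⟩
    exact ⟨(hside x hx1.1.le (by linarith [hx1.2])).1, hx2.trans_eq (hr1 x).symm⟩
  have hJ2 : ∫⁻ x in Set.Ioc 0 (2 * η) ∩ {x : ℝ | c * n ≤ ‖recipSum v (x * e)‖},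
      ENNReal.ofReal (rootProd v ((x : ℝ) * e) ^ q) ≤ J := by
    have := setLIntegral_line b hue (Set.Ioc 0 (2 * η) ∩ {x : ℝ | c * n ≤ ‖recipSum v (x * e)‖}) F
    simp only [hF, hp2] at this
    rw [← this]
    refine lintegral_mono_set ?_
    rintro _ ⟨x, ⟨hx1, hx2⟩, rfl⟩
    exact ⟨(hside x hx1.1.le (by linarith [hx1.2])).2, hx2.trans_eq (hr2 x).symm⟩
  have hI1 : ∫⁻ z in (fun x : ℝ => b + x * u) '' Set.Ioc 0 η, F z ∂(Measure.hausdorffMeasure 1) ≤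
      J + J + ENNReal.ofReal η * E := by
    rw [setLIntegral_line b hu]
    simp only [hF, hp1]
    refine (H n v q M hq (fun j => hK _ (hw j)) (fun j => hK' _ (hw j)) hnv ?_).trans ?_
    · intro x hx
      rw [← hp1]
      exact hM _ (hcl.frontier_subset (hside x hx.1 (by linarith [hx.2])).1)
    · exact add_le_add_left (add_le_add hJ1 hJ2) _
  have hI2 : ∫⁻ z in (fun x : ℝ => b + x * (u * e)) '' Set.Ioc 0 η, F z
      ∂(Measure.hausdorffMeasure 1) ≤ J + J + ENNReal.ofReal η * E := by
    rw [setLIntegral_line b hue]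
    simp only [hF, hp2]
    have := H n v' q M hq ?_ ?_ ?_ ?_
    · simp only [hp1', hp2', hr1', hr2'] at this
      exact this.trans (add_le_add_left (add_le_add hJ2 hJ1) _)
    · intro j
      have := hK' _ (hw j)
      have e1 : (starRingEnd ℂ) (v j) * e = (starRingEnd ℂ) (v j * (starRingEnd ℂ) e) := by simp
      simp only [hv']
      rw [e1, Complex.conj_im]; linarith
    · intro j
      have e1 : (starRingEnd ℂ) (v j) * e * (starRingEnd ℂ) e = (starRingEnd ℂ) (v j) := by
        linear_combination (starRingEnd ℂ) (v j) * hee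
      simp only [hv']
      rw [e1, Complex.conj_im]; linarith [hK _ (hw j)]
    · intro j; simp only [hv']; rw [norm_mul, RCLike.norm_conj, he, mul_one]; exact hnv j
    · intro x hx
      rw [hp1', ← hp2]
      exact hM _ (hcl.frontier_subset (hside x hx.1 (by linarith [hx.2])).2)
  have hI0 : ∫⁻ z in {b}, F z ∂(Measure.hausdorffMeasure 1) = 0 := by
    have : NullSingletonClass (Measure.hausdorffMeasure 1 : Measure ℂ) :=
      Measure.nullSingletonClass_hausdorff ℂ one_pos
    exact setLIntegral_measure_zero _ _ (measure_singleton b)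
  rw [one_mul]
  calc _ ≤ ∫⁻ z in {b} ∪ ((fun x : ℝ => b + x * u) '' Set.Ioc 0 η ∪
      (fun x : ℝ => b + x * (u * e)) '' Set.Ioc 0 η), F z ∂(Measure.hausdorffMeasure 1) :=
        lintegral_mono_set hsub
    _ ≤ 0 + ((J + J + ENNReal.ofReal η * E) + (J + J + ENNReal.ofReal η * E)) := by
        refine (lintegral_union_le _ _ _).trans (add_le_add hI0.le ?_)
        exact (lintegral_union_le _ _ _).trans (add_le_add hI1 hI2)
    _ = ENNReal.ofReal 4 * J + ENNReal.ofReal (2 * η) * E := by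
        rw [ENNReal.ofReal_mul two_pos.le]
        simp only [ENNReal.ofReal_ofNat]; ring
    _ ≤ _ := by
        rw [mul_add]
        exact add_le_add (mul_le_mul_left (ENNReal.ofReal_le_ofReal (by linarith)) _)
          (mul_le_mul_left (ENNReal.ofReal_le_ofReal (by linarith)) _)

end WedgeAt

/-! ### Patching the local estimates by compactness. -/

namespace LocalEstimate

variable {K S T : Set ℂ}

theorem mono (h : LocalEstimate K T) (hST : S ⊆ T) : LocalEstimate K S := by
  obtain ⟨c, hc, κ, hκ, C, hC, H⟩ := h
  refine ⟨c, hc, κ, hκ, C, hC, fun q n w M hq hM0 hw hM => ?_⟩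
  exact (lintegral_mono_set (Set.inter_subset_inter_left _ hST)).trans (H q n w M hq hM0 hw hM)

theorem union (h₁ : LocalEstimate K S) (h₂ : LocalEstimate K T) : LocalEstimate K (S ∪ T) := by
  obtain ⟨c₁, hc₁, κ₁, hκ₁, C₁, hC₁, H₁⟩ := h₁
  obtain ⟨c₂, hc₂, κ₂, hκ₂, C₂, hC₂, H₂⟩ := h₂
  refine ⟨min c₁ c₂, lt_min hc₁ hc₂, min κ₁ κ₂, lt_min hκ₁ hκ₂, C₁ + C₂, by positivity,
    fun q n w M hq hM0 hw hM => ?_⟩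
  have key : ∀ c κ C : ℝ, min c₁ c₂ ≤ c → min κ₁ κ₂ ≤ κ →
      ENNReal.ofReal C * ((∫⁻ z in frontier K ∩ {z | c * n ≤ ‖recipSum w z‖},
        ENNReal.ofReal (rootProd w z ^ q) ∂(Measure.hausdorffMeasure 1)) +
        ENNReal.ofReal ((Real.exp (-(κ * n)) * M) ^ q)) ≤
      ENNReal.ofReal C * ((∫⁻ z in frontier K ∩ {z | min c₁ c₂ * n ≤ ‖recipSum w z‖},
        ENNReal.ofReal (rootProd w z ^ q) ∂(Measure.hausdorffMeasure 1)) +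
        ENNReal.ofReal ((Real.exp (-(min κ₁ κ₂ * n)) * M) ^ q)) := by
    intro c κ C hc hκ
    refine mul_le_mul_right (add_le_add (lintegral_mono_set ?_) ?_) _
    · rintro z ⟨hz1, hz2⟩
      exact ⟨hz1, le_trans (mul_le_mul_of_nonneg_right hc n.cast_nonneg) hz2⟩
    · gcongr
  rw [Set.union_inter_distrib_right, ENNReal.ofReal_add hC₁ hC₂, add_mul]
  exact (lintegral_union_le _ _ _).trans (add_le_add
    ((H₁ q n w M hq hM0 hw hM).trans (key _ _ _ (min_le_left _ _) (min_le_left _ _)))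
    ((H₂ q n w M hq hM0 hw hM).trans (key _ _ _ (min_le_right _ _) (min_le_right _ _))))

theorem empty : LocalEstimate K ∅ :=
  ⟨1, one_pos, 1, one_pos, 0, le_rfl, fun q n w M _ _ _ _ => by simp⟩

end LocalEstimate

/-- From every boundary point in `S` starts a boundary segment of length `ℓ`. -/
def HasSegments (K S : Set ℂ) (ℓ : ℝ) : Prop :=
  ∀ z ∈ S ∩ frontier K, ∃ u : ℂ, ‖u‖ = 1 ∧ ∀ x : ℝ, 0 ≤ x → x ≤ ℓ → z + x * u ∈ frontier K

/-- The properties of the boundary which are first proved locally. -/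
def RegularBoundaryOn (K S : Set ℂ) : Prop :=
  LocalEstimate K S ∧ (∃ ℓ > 0, HasSegments K S ℓ) ∧
    (Measure.hausdorffMeasure 1 : Measure ℂ) (S ∩ frontier K) < ⊤

theorem hausdorffMeasure_line_lt_top (b : ℂ) {u : ℂ} (hu : ‖u‖ = 1) {T : Set ℝ} {r s : ℝ}
    (hT : T ⊆ Set.Icc r s) :
    (Measure.hausdorffMeasure 1 : Measure ℂ) ((fun x : ℝ => b + x * u) '' T) < ⊤ := by
  rw [(isometry_line b hu).hausdorffMeasure_image (Or.inl zero_le_one), hausdorffMeasure_real]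
  exact (measure_mono hT).trans_lt (by simp)

theorem FlatAt.exists_regularBoundaryOn {K : Set ℂ} {b u : ℂ} {ℓ : ℝ} (h : FlatAt K b u ℓ)
    (hconv : Convex ℝ K) (hcl : IsClosed K) (hbd : Bornology.IsBounded K)
    (hi : (interior K).Nonempty) : ∃ U ∈ nhds b, RegularBoundaryOn K U := by
  obtain ⟨U, hU, hest⟩ := h.exists_localEstimate hconv hcl hbd hi
  obtain ⟨ρ, hρ, h₀, hh, hρℓ, hrect⟩ := h.exists_rectangle hconv hi
  have hsub := h.frontier_subset hcl hrect
  obtain ⟨hu, hℓ, hK, h1, h2⟩ := h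
  have hu0 : u ≠ 0 := by rintro rfl; simp at hu
  have huu := conj_mul_self_of_norm_one hu
  refine ⟨U ∩ Metric.ball b (min ρ (2 * h₀)),
    Filter.inter_mem hU (Metric.ball_mem_nhds _ (by positivity)),
    hest.mono Set.inter_subset_left, ⟨ℓ / 2, by positivity, ?_⟩, ?_⟩
  · rintro z ⟨⟨-, hz⟩, hzf⟩
    obtain ⟨x₀, hx₀, rfl⟩ := hsub ⟨hz, hzf⟩
    refine ⟨u, hu, fun x hx0 hx => ?_⟩
    simp only [Set.mem_ofPred_eq] at hx₀
    have hx₁ := (abs_lt.mp hx₀).1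
    have hx₂ := (abs_lt.mp hx₀).2
    have := line_mem_frontier (b := b - ℓ * u) (u := u) (c := (starRingEnd ℂ) u) (L := 2 * ℓ)
      (x := ℓ + x₀ + x) hconv (by positivity) h2
      (by convert h1 using 1; push_cast; ring) (by simp [hu0]) ?_ ?_ (by linarith) (by linarith)
    · convert this using 1; push_cast; ring
    · intro w hw
      have e1 : (w - (b - ℓ * u)) * (starRingEnd ℂ) u = (w - b) * (starRingEnd ℂ) u + ℓ := by
        linear_combination (ℓ : ℂ) * huu
      rw [e1]; simpa using hK w hw
    · rw [mul_comm, huu, Complex.one_im]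
  · refine (measure_mono ?_).trans_lt (hausdorffMeasure_line_lt_top b hu (T := {x | |x| < ρ})
      (r := -ρ) (s := ρ) fun x hx => abs_le.mp (le_of_lt hx))
    rintro z ⟨⟨-, hz⟩, hzf⟩
    exact hsub ⟨hz, hzf⟩

theorem WedgeAt.exists_regularBoundaryOn {K : Set ℂ} {b u e : ℂ} {ℓ : ℝ} (h : WedgeAt K b u e ℓ)
    (hconv : Convex ℝ K) (hcl : IsClosed K) (hbd : Bornology.IsBounded K) (hbK : b ∈ K) :
    ∃ U ∈ nhds b, RegularBoundaryOn K U := by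
  obtain ⟨U, hU, hest⟩ := h.exists_localEstimate hconv hcl hbd hbK
  have hside := fun x : ℝ => h.side_mem_frontier hconv hbK (x := x)
  have hℓ : 0 < ℓ := h.2.2.2.1
  have hu : ‖u‖ = 1 := h.1
  have hue : ‖u * e‖ = 1 := by rw [norm_mul, hu, h.2.1, one_mul]
  obtain ⟨ρ, hρ, hsub⟩ := h.frontier_subset hconv hcl hbK (half_pos hℓ)
  refine ⟨U ∩ Metric.ball b ρ, Filter.inter_mem hU (Metric.ball_mem_nhds _ hρ),
    hest.mono Set.inter_subset_left, ⟨ℓ / 2, by positivity, ?_⟩, ?_⟩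
  · rintro z ⟨⟨-, hz⟩, hzf⟩
    rcases hsub ⟨hz, hzf⟩ with hzb | ⟨t, ht, rfl⟩ | ⟨t, ht, rfl⟩
    · rw [Set.mem_singleton_iff.mp hzb]
      exact ⟨u, hu, fun x hx0 hx => (hside x hx0 (by linarith)).1⟩
    · refine ⟨u, hu, fun x hx0 hx => ?_⟩
      have := (hside (t + x) (by linarith [ht.1]) (by linarith [ht.2])).1
      convert this using 1; push_cast; ring
    · refine ⟨u * e, hue, fun x hx0 hx => ?_⟩
      have := (hside (t + x) (by linarith [ht.1]) (by linarith [ht.2])).2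
      convert this using 1; push_cast; ring
  · have hsub' : U ∩ Metric.ball b ρ ∩ frontier K ⊆ _ := fun z hz => hsub ⟨hz.1.2, hz.2⟩
    have : NullSingletonClass (Measure.hausdorffMeasure 1 : Measure ℂ) :=
      Measure.nullSingletonClass_hausdorff ℂ one_pos
    refine (measure_mono hsub').trans_lt ((measure_union_le _ _).trans_lt ?_)
    rw [measure_singleton, zero_add]
    exact (measure_union_le _ _).trans_lt (ENNReal.add_lt_top.mpr
      ⟨hausdorffMeasure_line_lt_top b hu Set.Ioc_subset_Icc_self,
        hausdorffMeasure_line_lt_top b hue Set.Ioc_subset_Icc_self⟩)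

theorem IsConvexPolygonalDomain.convex {K : Set ℂ} (hK : IsConvexPolygonalDomain K) :
    Convex ℝ K := by
  obtain ⟨⟨V, rfl⟩, -⟩ := hK; exact convex_convexHull ℝ _

theorem IsConvexPolygonalDomain.isCompact {K : Set ℂ} (hK : IsConvexPolygonalDomain K) :
    IsCompact K := by
  obtain ⟨⟨V, rfl⟩, -⟩ := hK; exact V.finite_toSet.isCompact_convexHull ℝ

/-- All three properties pass to subsets and finite unions, so on the compact frontier it is enough
to have them near each point. -/
theorem IsConvexPolygonalDomain.regularBoundaryOn {K : Set ℂ} (hK : IsConvexPolygonalDomain K) :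
    RegularBoundaryOn K (frontier K) := by
  have hcl := hK.isCompact.isClosed
  have hbd := hK.isCompact.isBounded
  have hcomp : IsCompact (frontier K) := hK.isCompact.of_isClosed_subset isClosed_frontier
    hcl.frontier_subset
  refine hcomp.induction_on (p := RegularBoundaryOn K) ?_ ?_ ?_ ?_
  · exact ⟨LocalEstimate.empty, ⟨1, one_pos, fun z hz => by simp at hz⟩, by simp⟩
  · rintro S T hST ⟨h1, ⟨ℓ, hℓ, h2⟩, h3⟩
    exact ⟨h1.mono hST, ⟨ℓ, hℓ, fun z hz => h2 z ⟨hST hz.1, hz.2⟩⟩,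
      (measure_mono (Set.inter_subset_inter_left _ hST)).trans_lt h3⟩
  · rintro S T ⟨h1, ⟨ℓ, hℓ, h2⟩, h3⟩ ⟨h1', ⟨ℓ', hℓ', h2'⟩, h3'⟩
    refine ⟨h1.union h1', ⟨min ℓ ℓ', lt_min hℓ hℓ', ?_⟩, ?_⟩
    · rintro z ⟨hz | hz, hzf⟩
      · obtain ⟨u, hu, h⟩ := h2 z ⟨hz, hzf⟩
        exact ⟨u, hu, fun x hx0 hx => h x hx0 (hx.trans (min_le_left _ _))⟩
      · obtain ⟨u, hu, h⟩ := h2' z ⟨hz, hzf⟩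
        exact ⟨u, hu, fun x hx0 hx => h x hx0 (hx.trans (min_le_right _ _))⟩
    · rw [Set.union_inter_distrib_right]
      exact (measure_union_le _ _).trans_lt (ENNReal.add_lt_top.mpr ⟨h3, h3'⟩)
  · intro b hb
    have hbK := hcl.frontier_subset hb
    rcases exists_flatAt_or_wedgeAt hK hb with ⟨u, ℓ, h⟩ | ⟨u, e, ℓ, h⟩
    · obtain ⟨U, hU, hreg⟩ := h.exists_regularBoundaryOn hK.convex hcl hbd hK.2
      exact ⟨U, mem_nhdsWithin_of_mem_nhds hU, hreg⟩
    · obtain ⟨U, hU, hreg⟩ := h.exists_regularBoundaryOn hK.convex hcl hbd hbK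
      exact ⟨U, mem_nhdsWithin_of_mem_nhds hU, hreg⟩

/-! ### A Nikolskii inequality with subexponential constant. -/

/-- On a segment starting at `z`, at one of finitely many scales, the mean of `log |P|` is almost as
large as `log |P z|`. -/
theorem exists_scale {ε L : ℝ} (hε : 0 < ε) (hL : 0 < L) :
    ∃ δ > 0, ∀ (n : ℕ) (w : Fin n → ℂ) (z u : ℂ), ‖u‖ = 1 → (∀ j, z ≠ w j) →
      ∃ τ, δ ≤ τ ∧ τ ≤ L ∧
        ∑ j, Real.log ‖z - w j‖ - ε * n ≤ ∑ j, avgLog z u 0 τ (w j) := by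
  -- `exp (-2)` absorbs the 2 of `log_sub_two_le_avgLog`; `ε / 4` makes the loss `2 * θ` at most
  -- ε/2.
  set θ := min (1 / 2) (min (Real.exp (-2)) (ε / 4)) with hθ
  have hθ0 : 0 < θ := by positivity
  have hθ1 : θ ≤ 1 / 2 := min_le_left _ _
  have hθ2 : Real.log θ ≤ -2 := by
    have := Real.log_le_log hθ0 ((min_le_right _ _).trans (min_le_left _ _))
    rwa [Real.log_exp] at this
  have hθ3 : θ ≤ ε / 4 := (min_le_right _ _).trans (min_le_right _ _)
  set C := 2 - Real.log θ with hC
  have hC0 : 0 < C := by linarith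
  obtain ⟨m, hm⟩ := exists_nat_gt (2 * C / ε)
  have hm0 : (0 : ℝ) < m := lt_trans (by positivity) hm
  have hmpos : 0 < m := by exact_mod_cast hm0
  rw [div_lt_iff₀ hε] at hm
  set τ : ℕ → ℝ := fun k => L * (θ ^ 2) ^ k with hτ
  have hτ0 : ∀ k, 0 < τ k := fun k => by positivity
  have hsq : θ ^ 2 ≤ 1 := by nlinarith
  refine ⟨L * (θ ^ 2) ^ m, by positivity, fun n w z u hu hz => ?_⟩
  have hr : ∀ j, 0 < ‖z - w j‖ := fun j => norm_pos_iff.mpr (sub_ne_zero.mpr (hz j))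
  -- For τ ≤ θr, with r the distance of the zero from z, the logarithm hardly varies on the segment;
  -- for r ≤ θτ, its mean exceeds log r. Only a scale comparable with r costs C.
  have hloss : ∀ k j, Real.log ‖z - w j‖ - avgLog z u 0 (τ k) (w j) ≤
      2 * θ + C * (if θ * τ k < ‖z - w j‖ ∧ θ * ‖z - w j‖ < τ k then 1 else 0) := by
    intro k j
    have h1 := log_sub_two_le_avgLog (z₀ := z) hu (a := 0) (hτ0 k) (w j)
    by_cases ha : τ k ≤ θ * ‖z - w j‖
    · have h2 : Real.log ‖z - w j‖ - 2 * θ ≤ avgLog z u 0 (τ k) (w j) := by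
        refine le_avgLog_of_forall (hτ0 k) fun x hx => ?_
        refine log_sub_two_mul_le_log (hr j) hθ1 hθ0.le ?_
        have h3 : ‖z - w j‖ ≤ ‖z + x * u - w j‖ + ‖(x : ℂ) * u‖ := by
          calc ‖z - w j‖ = ‖(z + x * u - w j) - x * u‖ := by ring_nf
            _ ≤ _ := norm_sub_le _ _
        rw [norm_mul, hu, mul_one, Complex.norm_real, Real.norm_eq_abs, abs_of_nonneg hx.1] at h3
        linarith [hx.2]
      have h4 : 0 ≤ C * (if θ * τ k < ‖z - w j‖ ∧ θ * ‖z - w j‖ < τ k then (1 : ℝ) else 0) := by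
        split_ifs <;> simp [hC0.le]
      linarith
    · push Not at ha
      by_cases hb : ‖z - w j‖ ≤ θ * τ k
      · have h2 := Real.log_le_log (hr j) hb
        rw [Real.log_mul hθ0.ne' (hτ0 k).ne'] at h2
        rw [if_neg (fun h => absurd h.1 (not_lt.mpr hb))]
        linarith
      · push Not at hb
        rw [if_pos ⟨hb, ha⟩]
        have h2 := Real.log_le_log (mul_pos hθ0 (hr j)) ha.le
        rw [Real.log_mul hθ0.ne' (hr j).ne'] at h2
        linarith
  -- Consecutive scales differ by the factor θ², so a zero is comparable with at most one of them.
  have hone : ∀ j, ∑ k ∈ Finset.range m,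
      (if θ * τ k < ‖z - w j‖ ∧ θ * ‖z - w j‖ < τ k then (1 : ℝ) else 0) ≤ 1 := by
    intro j
    rw [Finset.sum_boole]
    have : (Finset.filter (fun k => θ * τ k < ‖z - w j‖ ∧ θ * ‖z - w j‖ < τ k)
        (Finset.range m)).card ≤ 1 := by
      have hlt : ∀ k k', θ * τ k < ‖z - w j‖ → θ * ‖z - w j‖ < τ k' → k' ≤ k := by
        intro k k' h1 h2
        by_contra hcon
        push Not at hcon
        have h3 : τ k' ≤ θ ^ 2 * τ k := by
          have : (θ ^ 2) ^ k' ≤ (θ ^ 2) ^ (k + 1) :=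
            pow_le_pow_of_le_one (by positivity) hsq hcon
          calc τ k' ≤ L * (θ ^ 2) ^ (k + 1) := mul_le_mul_of_nonneg_left this hL.le
            _ = _ := by simp only [hτ]; ring
        nlinarith
      refine Finset.card_le_one.mpr fun k hk k' hk' => ?_
      rw [Finset.mem_filter] at hk hk'
      exact le_antisymm (hlt k' k hk'.2.1 hk.2.2) (hlt k k' hk.2.1 hk'.2.2)
    exact_mod_cast this
  -- Averaged over the m scales, each zero costs at most 2θ + C/m ≤ ε, so some scale has total loss
  -- at most ε n.
  have htot : ∑ k ∈ Finset.range m, ∑ j, (Real.log ‖z - w j‖ - avgLog z u 0 (τ k) (w j)) ≤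
      ∑ k ∈ Finset.range m, ε * n := by
    calc _ ≤ ∑ k ∈ Finset.range m, ∑ j, (2 * θ + C *
          (if θ * τ k < ‖z - w j‖ ∧ θ * ‖z - w j‖ < τ k then 1 else 0)) :=
          Finset.sum_le_sum fun k _ => Finset.sum_le_sum fun j _ => hloss k j
      _ = ∑ j, (m * (2 * θ) + C * ∑ k ∈ Finset.range m,
          (if θ * τ k < ‖z - w j‖ ∧ θ * ‖z - w j‖ < τ k then (1 : ℝ) else 0)) := by
          rw [Finset.sum_comm]
          refine Finset.sum_congr rfl fun j _ => ?_
          rw [Finset.sum_add_distrib, Finset.sum_const, Finset.card_range, nsmul_eq_mul,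
            ← Finset.mul_sum]
      _ ≤ ∑ _j : Fin n, (m * ε) := by
          refine Finset.sum_le_sum fun j _ => ?_
          have := mul_le_mul_of_nonneg_left (hone j) hC0.le
          nlinarith
      _ = _ := by simp; ring
  obtain ⟨k, hk, hkle⟩ := Finset.exists_le_of_sum_le (Finset.nonempty_range_iff.mpr hmpos.ne') htot
  refine ⟨τ k, ?_, ?_, ?_⟩
  · exact mul_le_mul_of_nonneg_left (pow_le_pow_of_le_one (by positivity) hsq
      (Finset.mem_range.mp hk).le) hL.le
  · exact mul_le_of_le_one_right hL.le (pow_le_one₀ (by positivity) hsq)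
  · rw [Finset.sum_sub_distrib] at hkle
    linarith

theorem setLIntegral_segment_le {K : Set ℂ} {z u : ℂ} (hu : ‖u‖ = 1) {τ : ℝ}
    (h : ∀ x : ℝ, 0 ≤ x → x ≤ τ → z + x * u ∈ frontier K) (f : ℂ → ℝ≥0∞) :
    ∫⁻ x in Set.Icc (0 : ℝ) (0 + τ), f (z + x * u) ≤
      ∫⁻ y in frontier K, f y ∂(Measure.hausdorffMeasure 1) := by
  rw [← setLIntegral_line z hu]
  refine lintegral_mono_set ?_
  rintro _ ⟨x, hx, rfl⟩
  exact h x hx.1 (by linarith [hx.2])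

/-- A Nikolskii type inequality with subexponential constant. -/
theorem exists_nikolskii {K : Set ℂ} {L ε : ℝ} (hL : 0 < L) (hε : 0 < ε)
    (hK : HasSegments K (frontier K) L) :
    ∃ A > 0, ∀ (q : ℝ) (n : ℕ) (w : Fin n → ℂ), 0 < q → ∀ z ∈ frontier K,
      ENNReal.ofReal (rootProd w z ^ q) ≤ ENNReal.ofReal (A * Real.exp (q * (ε * n))) *
        ∫⁻ y in frontier K, ENNReal.ofReal (rootProd w y ^ q) ∂(Measure.hausdorffMeasure 1) := by
  obtain ⟨δ, hδ, H⟩ := exists_scale hε hL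
  -- The smallest scale `δ` depends only on `L` and `ε`, so the constant is uniform in q, n, the
  -- zeros and z.
  refine ⟨δ⁻¹, by positivity, fun q n w hq z hzf => ?_⟩
  by_cases hz : ∀ j, z ≠ w j
  · obtain ⟨u, hu, hseg⟩ := hK z ⟨hzf, hzf⟩
    obtain ⟨τ, hτ, hτL, hle⟩ := H n w z u hu hz
    have h1 := (ofReal_mul_exp_le_lintegral_rootProd w hu (hδ.trans_le hτ) hq hle).trans
      (setLIntegral_segment_le (K := K) hu (fun x h0 hx => hseg x h0 (hx.trans hτL))
        (fun y => ENNReal.ofReal (rootProd w y ^ q)))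
    refine le_trans ?_ (mul_le_mul_right h1 _)
    rw [← ENNReal.ofReal_mul (by positivity)]
    refine ENNReal.ofReal_le_ofReal ?_
    rw [rootProd_eq_exp hz, ← Real.exp_mul, mul_comm (∑ j, _) q]
    have e1 : δ⁻¹ * Real.exp (q * (ε * n)) * (τ * Real.exp (q * (∑ j, Real.log ‖z - w j‖ - ε * n))) =
        δ⁻¹ * τ * Real.exp (q * ∑ j, Real.log ‖z - w j‖) := by
      rw [mul_sub, Real.exp_sub]; field_simp
    rw [e1]
    refine le_mul_of_one_le_left (Real.exp_pos _).le ?_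
    rw [← div_eq_inv_mul, le_div_iff₀ hδ]; linarith
  · rw [rootProd_eq_zero hz, Real.zero_rpow hq.ne']; simp

/-! ### Passage to polynomials, large and small degrees. -/

theorem exists_rootProd_of_natDegree_eq {p : Polynomial ℂ} {n : ℕ} (hn : p.natDegree = n) :
    ∃ w : Fin n → ℂ, (p ≠ 0 → ∀ j, p.IsRoot (w j)) ∧
      (∀ z, ‖p.eval z‖ = ‖p.leadingCoeff‖ * rootProd w z) ∧
      ∀ z, p.eval z ≠ 0 → p.derivative.eval z = p.eval z * recipSum w z := by
  have hsp := IsAlgClosed.splits p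
  have hlen : p.roots.toList.length = n := by
    rw [Multiset.length_toList, IsAlgClosed.card_roots_eq_natDegree, hn]
  obtain ⟨w, hroots⟩ : ∃ w : Fin n → ℂ, p.roots = ((List.ofFn w : List ℂ) : Multiset ℂ) := by
    subst hlen
    exact ⟨fun j => p.roots.toList.get j, by rw [List.ofFn_get, Multiset.coe_toList]⟩
  refine ⟨w, fun hp j => ?_, fun z => ?_, fun z hz => ?_⟩
  · have : w j ∈ p.roots := by
      rw [hroots, Multiset.mem_coe, List.mem_ofFn]; exact ⟨j, rfl⟩
    exact (Polynomial.mem_roots hp).mp this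
  · rw [hsp.eval_eq_prod_roots, hroots, norm_mul, Multiset.map_coe, Multiset.prod_coe,
      List.map_ofFn, List.prod_ofFn, norm_prod]
    rfl
  · rw [← mul_div_cancel_left₀ (p.derivative.eval z) hz, mul_div_assoc,
      hsp.eval_derivative_div_eval_of_ne_zero hz, hroots, Multiset.map_coe, Multiset.sum_coe,
      List.map_ofFn, List.sum_ofFn]
    unfold recipSum
    simp

theorem natDegree_derivative_eq_sub_one {p : Polynomial ℂ} {n : ℕ} (hn : p.natDegree = n)
    (h0 : 0 < n) :
    p.derivative.natDegree = n - 1 ∧ p.derivative.leadingCoeff = p.leadingCoeff * n := by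
  have hp : p.leadingCoeff ≠ 0 := by
    rw [Polynomial.leadingCoeff_ne_zero]; rintro rfl; simp at hn; omega
  have hco : p.derivative.coeff (n - 1) = p.leadingCoeff * n := by
    rw [Polynomial.coeff_derivative, Nat.sub_add_cancel h0, Polynomial.leadingCoeff, hn,
      Nat.cast_sub h0]; simp
  have hdeg : p.derivative.natDegree = n - 1 := by
    refine Polynomial.natDegree_eq_of_le_of_coeff_ne_zero
      (hn ▸ Polynomial.natDegree_derivative_le p) ?_
    rw [hco]
    exact mul_ne_zero hp (by exact_mod_cast h0.ne')
  exact ⟨hdeg, by rw [Polynomial.leadingCoeff, hdeg, hco]⟩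

theorem enorm_rpow_eq_ofReal (x : ℂ) {q : ℝ} (hq : 0 < q) : ‖x‖ₑ ^ q = ENNReal.ofReal (‖x‖ ^ q) := by
  rw [← ofReal_norm, ENNReal.ofReal_rpow_of_nonneg (norm_nonneg _) hq.le]

/-- Maximum modulus principle for ∏ (z - w j). -/
theorem exists_frontier_max {K : Set ℂ} (hK : IsConvexPolygonalDomain K) {n : ℕ} (w : Fin n → ℂ) :
    ∃ z ∈ frontier K, ∀ y ∈ K, rootProd w y ≤ rootProd w z := by
  have hd : Differentiable ℂ fun z => ∏ j, (z - w j) := by fun_prop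
  obtain ⟨z, hz, hmax⟩ := Complex.exists_mem_frontier_isMaxOn_norm hK.isCompact.isBounded
    (hK.2.mono interior_subset) (hd.diffContOnCl (s := K))
  refine ⟨z, hz, fun y hy => ?_⟩
  have := hmax (subset_closure hy)
  simpa [rootProd, norm_prod] using this

/-- The case of large degree. -/
theorem exists_large_degree {K : Set ℂ} (hK : IsConvexPolygonalDomain K) {q : ℝ} (hq : 0 < q) :
    ∃ N : ℕ, ∃ D : ℝ, 0 ≤ D ∧ ∃ c > 0, ∀ (n : ℕ) (w : Fin n → ℂ), N ≤ n → (∀ j, w j ∈ K) →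
      ∫⁻ z in frontier K, ENNReal.ofReal (rootProd w z ^ q) ∂(Measure.hausdorffMeasure 1) ≤
        ENNReal.ofReal D * ∫⁻ z in frontier K ∩ {z | c * n ≤ ‖recipSum w z‖},
          ENNReal.ofReal (rootProd w z ^ q) ∂(Measure.hausdorffMeasure 1) := by
  obtain ⟨⟨c, hc, κ, hκ, C, hC, H⟩, ⟨L, hL, hseg⟩, hfin⟩ := hK.regularBoundaryOn
  rw [Set.inter_self] at hfin
  -- With ε = κ/2 the Nikolskii growth cancels only half of the decay, leaving the factor exp (-q κ
  -- n / 2).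
  obtain ⟨A, hA, hnik⟩ := exists_nikolskii hL (half_pos hκ) hseg
  have hlim : Filter.Tendsto (fun n : ℕ => C * A * Real.exp (-(q * (κ / 2) * n))) Filter.atTop
      (nhds (C * A * 0)) := by
    refine Filter.Tendsto.const_mul _ (Real.tendsto_exp_neg_atTop_nhds_zero.comp ?_)
    exact tendsto_natCast_atTop_atTop.const_mul_atTop (by positivity)
  rw [mul_zero] at hlim
  obtain ⟨N, hN⟩ := Filter.eventually_atTop.mp (hlim.eventually (gt_mem_nhds one_half_pos))
  refine ⟨N, 2 * C, by positivity, c, hc, fun n w hn hw => ?_⟩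
  obtain ⟨z, hz, hmax⟩ := exists_frontier_max hK w
  have h1 := H q n w (rootProd w z) hq (rootProd_nonneg _ _) hw hmax
  rw [Set.inter_self] at h1
  have h2 := hnik q n w hq z hz
  set I := ∫⁻ z in frontier K, ENNReal.ofReal (rootProd w z ^ q) ∂(Measure.hausdorffMeasure 1)
    with hI
  set J := ∫⁻ z in frontier K ∩ {z | c * n ≤ ‖recipSum w z‖},
    ENNReal.ofReal (rootProd w z ^ q) ∂(Measure.hausdorffMeasure 1) with hJ
  -- Finiteness is what allows `I / 2` to be subtracted from both sides below.
  have hItop : I ≠ ⊤ := by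
    refine ((setLIntegral_mono measurable_const (g := fun _ => ENNReal.ofReal (rootProd w z ^ q))
      fun y hy => ?_).trans_lt ?_).ne
    · exact ENNReal.ofReal_le_ofReal (Real.rpow_le_rpow (rootProd_nonneg _ _)
        (hmax y (hK.isCompact.isClosed.frontier_subset hy)) hq.le)
    · rw [setLIntegral_const]; exact ENNReal.mul_lt_top ENNReal.ofReal_lt_top hfin
  have h3 : ENNReal.ofReal C * ENNReal.ofReal ((Real.exp (-(κ * n)) * rootProd w z) ^ q) ≤
      ENNReal.ofReal (1 / 2) * I := by
    rw [Real.mul_rpow (Real.exp_pos _).le (rootProd_nonneg _ _), ENNReal.ofReal_mul (by positivity)]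
    calc _ ≤ ENNReal.ofReal C * (ENNReal.ofReal (Real.exp (-(κ * n)) ^ q) *
          (ENNReal.ofReal (A * Real.exp (q * (κ / 2 * n))) * I)) := by gcongr
      _ = ENNReal.ofReal (C * A * Real.exp (-(q * (κ / 2) * n))) * I := by
          rw [← mul_assoc, ← mul_assoc, ← ENNReal.ofReal_mul hC, ← ENNReal.ofReal_mul (by positivity)]
          congr 2
          rw [← Real.exp_mul]
          have : Real.exp (-(κ * n) * q) * Real.exp (q * (κ / 2 * n)) =
              Real.exp (-(q * (κ / 2) * n)) := by
            rw [← Real.exp_add]; congr 1; ring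
          rw [← this]; ring
      _ ≤ _ := by gcongr; exact (hN n hn).le
  have h4 : I ≤ ENNReal.ofReal C * J + ENNReal.ofReal (1 / 2) * I :=
    h1.trans (by rw [mul_add]; exact add_le_add_right h3 _)
  have h5 : ENNReal.ofReal (1 / 2) * I + ENNReal.ofReal (1 / 2) * I = I := by
    rw [← add_mul, ← ENNReal.ofReal_add (by norm_num) (by norm_num)]; norm_num
  have h6 : ENNReal.ofReal (1 / 2) * I ≤ ENNReal.ofReal C * J := by
    have hne : ENNReal.ofReal (1 / 2) * I ≠ ⊤ := ENNReal.mul_ne_top ENNReal.ofReal_ne_top hItop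
    refine (ENNReal.add_le_add_iff_right hne).mp ?_
    rw [h5]; exact h4
  calc I = ENNReal.ofReal (1 / 2) * I + ENNReal.ofReal (1 / 2) * I := h5.symm
    _ ≤ ENNReal.ofReal C * J + ENNReal.ofReal C * J := add_le_add h6 h6
    _ = _ := by rw [two_mul, ENNReal.ofReal_add hC hC, add_mul]

theorem rootProd_le_pow {n : ℕ} {w : Fin n → ℂ} {z : ℂ} {d : ℝ} (h : ∀ j, ‖z - w j‖ ≤ d) :
    rootProd w z ≤ d ^ n := by
  calc rootProd w z ≤ ∏ _j : Fin n, d := Finset.prod_le_prod (fun _ _ => norm_nonneg _) fun j _ => h j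
    _ = d ^ n := by simp

/-- The bound log L - 2 holds for every position of a zero, so nothing is required of the points `w
j`; this lets it be applied to the derivative. -/
theorem exists_lower_bound {K : Set ℂ} {L q : ℝ} (hL : 0 < L) (hq : 0 < q) (hne : (frontier K).Nonempty)
    (hseg : HasSegments K (frontier K) L) (m : ℕ) (w : Fin m → ℂ) :
    ENNReal.ofReal (L * Real.exp (q * (m * (Real.log L - 2)))) ≤
      ∫⁻ y in frontier K, ENNReal.ofReal (rootProd w y ^ q) ∂(Measure.hausdorffMeasure 1) := by
  obtain ⟨z, hz⟩ := hne
  obtain ⟨u, hu, h⟩ := hseg z ⟨hz, hz⟩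
  refine (ofReal_mul_exp_le_lintegral_rootProd w (z₀ := z) (a := 0) hu hL hq ?_).trans
    (setLIntegral_segment_le hu h (fun y => ENNReal.ofReal (rootProd w y ^ q)))
  calc (m : ℝ) * (Real.log L - 2) = ∑ _j : Fin m, (Real.log L - 2) := by
        rw [Finset.sum_const, Finset.card_univ, Fintype.card_fin, nsmul_eq_mul]
    _ ≤ _ := Finset.sum_le_sum fun j _ => log_sub_two_le_avgLog hu hL (w j)

/-- The inequality between the `q`-th powers of the norms. -/
theorem exists_pow_norm_le {K : Set ℂ} (hK : IsConvexPolygonalDomain K) {q : ℝ} (hq : 0 < q) :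
    ∃ D : ℝ, 0 < D ∧ ∀ n : ℕ, 1 ≤ n → ∀ p ∈ polynomialsWithZerosIn n K,
      ENNReal.ofReal ((n : ℝ) ^ q) * ∫⁻ z, ‖p.eval z‖ₑ ^ q ∂(boundaryArcLength K) ≤
        ENNReal.ofReal D * ∫⁻ z, ‖p.derivative.eval z‖ₑ ^ q ∂(boundaryArcLength K) := by
  obtain ⟨N, D₁, hD₁, c, hc, hlarge⟩ := exists_large_degree hK hq
  obtain ⟨-, ⟨L, hL, hseg⟩, hfin⟩ := hK.regularBoundaryOn
  rw [Set.inter_self] at hfin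
  set μ := (Measure.hausdorffMeasure 1 : Measure ℂ) (frontier K) with hμ
  have hne : (frontier K).Nonempty := by
    obtain ⟨z, hz, -⟩ := exists_frontier_max hK (n := 0) Fin.elim0
    exact ⟨z, hz⟩
  obtain ⟨d, hd1, hd⟩ : ∃ d : ℝ, 1 ≤ d ∧ ∀ x ∈ K, ∀ y ∈ K, ‖x - y‖ ≤ d := by
    obtain ⟨d, hd⟩ := Metric.isBounded_iff.mp hK.isCompact.isBounded
    exact ⟨max d 1, le_max_right _ _, fun x hx y hy => by
      rw [← dist_eq_norm]; exact (hd hx hy).trans (le_max_left _ _)⟩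
  -- A lower bound for the integral of the monic multiple of p', valid for all degrees below `N` at
  -- once.
  set B := L * Real.exp (-(q * (N * (|Real.log L| + 2)))) with hB
  have hBpos : 0 < B := by positivity
  set D₂ := (d ^ N) ^ q * μ.toReal / B with hD₂
  have hD₂0 : 0 ≤ D₂ := by positivity
  -- The two constants belong to degrees n ≥ N and n < N; the 1 only ensures positivity.
  refine ⟨D₁ * (c ^ q)⁻¹ + D₂ + 1, by positivity, fun n hn p hp => ?_⟩
  obtain ⟨hdeg, hzeros⟩ := hp
  have hnat : p.natDegree = n := Polynomial.natDegree_eq_of_degree_eq_some hdeg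
  have hp0 : p ≠ 0 := by rintro rfl; simp at hdeg
  have hlc : 0 < ‖p.leadingCoeff‖ := norm_pos_iff.mpr (Polynomial.leadingCoeff_ne_zero.mpr hp0)
  have hn0 : (0 : ℝ) < n := by exact_mod_cast hn
  obtain ⟨w, hwroot, hweval, hwder⟩ := exists_rootProd_of_natDegree_eq hnat
  have hwK : ∀ j, w j ∈ K := fun j => hzeros _ (hwroot hp0 j)
  unfold boundaryArcLength
  set ν := (Measure.hausdorffMeasure 1 : Measure ℂ) with hν
  have hIp : ∫⁻ z in frontier K, ‖p.eval z‖ₑ ^ q ∂ν = ENNReal.ofReal (‖p.leadingCoeff‖ ^ q) *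
      ∫⁻ z in frontier K, ENNReal.ofReal (rootProd w z ^ q) ∂ν := by
    rw [← lintegral_const_mul' _ _ ENNReal.ofReal_ne_top]
    refine lintegral_congr fun z => ?_
    rw [enorm_rpow_eq_ofReal _ hq, hweval, Real.mul_rpow hlc.le (rootProd_nonneg _ _),
      ENNReal.ofReal_mul (by positivity)]
  rw [hIp]
  rcases le_or_gt N n with hNn | hNn
  · have h1 : ENNReal.ofReal (‖p.leadingCoeff‖ ^ q) *
        ∫⁻ z in frontier K ∩ {z | c * n ≤ ‖recipSum w z‖}, ENNReal.ofReal (rootProd w z ^ q) ∂ν ≤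
        ENNReal.ofReal (((c * n) ^ q)⁻¹) * ∫⁻ z in frontier K, ‖p.derivative.eval z‖ₑ ^ q ∂ν := by
      rw [← lintegral_const_mul' _ _ ENNReal.ofReal_ne_top,
        ← lintegral_const_mul' _ _ ENNReal.ofReal_ne_top]
      refine (setLIntegral_mono' ?_ fun z hz => ?_).trans (lintegral_mono_set Set.inter_subset_left)
      · exact isClosed_frontier.measurableSet.inter
          (measurableSet_le measurable_const (measurable_recipSum w).norm)
      · rw [enorm_rpow_eq_ofReal _ hq, ← ENNReal.ofReal_mul (by positivity),
          ← ENNReal.ofReal_mul (by positivity), ← Real.mul_rpow hlc.le (rootProd_nonneg _ _), ← hweval]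
        refine ENNReal.ofReal_le_ofReal ?_
        rw [← div_eq_inv_mul, le_div_iff₀ (by positivity),
          ← Real.mul_rpow (norm_nonneg _) (by positivity)]
        refine Real.rpow_le_rpow (by positivity) ?_ hq.le
        by_cases h0 : p.eval z = 0
        · simp [h0]
        · rw [hwder z h0, norm_mul]
          exact mul_le_mul_of_nonneg_left hz.2 (norm_nonneg _)
    calc _ ≤ ENNReal.ofReal ((n : ℝ) ^ q) * (ENNReal.ofReal (‖p.leadingCoeff‖ ^ q) *
          (ENNReal.ofReal D₁ * ∫⁻ z in frontier K ∩ {z | c * n ≤ ‖recipSum w z‖},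
            ENNReal.ofReal (rootProd w z ^ q) ∂ν)) := by gcongr; exact hlarge n w hNn hwK
      _ = ENNReal.ofReal ((n : ℝ) ^ q) * ENNReal.ofReal D₁ * (ENNReal.ofReal (‖p.leadingCoeff‖ ^ q) *
          ∫⁻ z in frontier K ∩ {z | c * n ≤ ‖recipSum w z‖},
            ENNReal.ofReal (rootProd w z ^ q) ∂ν) := by ring
      _ ≤ ENNReal.ofReal ((n : ℝ) ^ q) * ENNReal.ofReal D₁ * (ENNReal.ofReal (((c * n) ^ q)⁻¹) *
          ∫⁻ z in frontier K, ‖p.derivative.eval z‖ₑ ^ q ∂ν) := by gcongr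
      _ = ENNReal.ofReal (D₁ * (c ^ q)⁻¹) * ∫⁻ z in frontier K, ‖p.derivative.eval z‖ₑ ^ q ∂ν := by
          rw [← mul_assoc, ← ENNReal.ofReal_mul (by positivity), ← ENNReal.ofReal_mul (by positivity)]
          congr 2
          rw [Real.mul_rpow hc.le hn0.le]
          field_simp
      _ ≤ _ := by gcongr; linarith
  -- For n < N the leading coefficient of p' supplies the factor n exactly, and the integrals for
  -- the two monic polynomials are bounded above and below in terms of N.
  · obtain ⟨hdeg', hlc'⟩ := natDegree_derivative_eq_sub_one hnat hn
    obtain ⟨w', -, hweval', -⟩ := exists_rootProd_of_natDegree_eq hdeg'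
    have hIp' : ∫⁻ z in frontier K, ‖p.derivative.eval z‖ₑ ^ q ∂ν =
        ENNReal.ofReal (‖p.leadingCoeff‖ ^ q) * (ENNReal.ofReal ((n : ℝ) ^ q) *
        ∫⁻ z in frontier K, ENNReal.ofReal (rootProd w' z ^ q) ∂ν) := by
      rw [← mul_assoc, ← ENNReal.ofReal_mul (by positivity),
        ← lintegral_const_mul' _ _ ENNReal.ofReal_ne_top]
      refine lintegral_congr fun z => ?_
      rw [enorm_rpow_eq_ofReal _ hq, hweval', hlc', norm_mul, Complex.norm_natCast,
        Real.mul_rpow (by positivity) (rootProd_nonneg _ _), Real.mul_rpow hlc.le hn0.le,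
        ENNReal.ofReal_mul (by positivity)]
    have hlow : ENNReal.ofReal B ≤ ∫⁻ z in frontier K, ENNReal.ofReal (rootProd w' z ^ q) ∂ν := by
      refine le_trans (ENNReal.ofReal_le_ofReal ?_) (exists_lower_bound hL hq hne hseg (n - 1) w')
      rw [hB]
      refine mul_le_mul_of_nonneg_left (Real.exp_le_exp.mpr ?_) hL.le
      rw [← mul_neg]
      refine mul_le_mul_of_nonneg_left ?_ hq.le
      have h1 : ((n - 1 : ℕ) : ℝ) ≤ N := by exact_mod_cast (by omega : n - 1 ≤ N)
      have h2 := neg_abs_le (Real.log L)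
      have h3 : (0 : ℝ) ≤ ((n - 1 : ℕ) : ℝ) := Nat.cast_nonneg _
      nlinarith [abs_nonneg (Real.log L)]
    have hup : ∫⁻ z in frontier K, ENNReal.ofReal (rootProd w z ^ q) ∂ν ≤
        ENNReal.ofReal ((d ^ N) ^ q) * μ := by
      refine (setLIntegral_mono measurable_const (g := fun _ => ENNReal.ofReal ((d ^ N) ^ q))
        fun y hy => ?_).trans_eq (setLIntegral_const _ _)
      refine ENNReal.ofReal_le_ofReal (Real.rpow_le_rpow (rootProd_nonneg _ _) ?_ hq.le)
      exact (rootProd_le_pow fun j =>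
        hd _ (hK.isCompact.isClosed.frontier_subset hy) _ (hwK j)).trans
        (pow_le_pow_right₀ hd1 hNn.le)
    have hratio : ENNReal.ofReal ((d ^ N) ^ q) * μ = ENNReal.ofReal D₂ * ENNReal.ofReal B := by
      rw [← ENNReal.ofReal_mul hD₂0, hD₂, div_mul_cancel₀ _ hBpos.ne', ENNReal.ofReal_mul (by positivity),
        ENNReal.ofReal_toReal hfin.ne]
    calc _ ≤ ENNReal.ofReal ((n : ℝ) ^ q) * (ENNReal.ofReal (‖p.leadingCoeff‖ ^ q) *
          (ENNReal.ofReal D₂ * ∫⁻ z in frontier K, ENNReal.ofReal (rootProd w' z ^ q) ∂ν)) := by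
          refine mul_le_mul_right (mul_le_mul_right (hup.trans ?_) _) _
          rw [hratio]; exact mul_le_mul_right hlow _
      _ = ENNReal.ofReal D₂ * ∫⁻ z in frontier K, ‖p.derivative.eval z‖ₑ ^ q ∂ν := by
          rw [hIp']; ring
      _ ≤ _ := by
          gcongr
          have : 0 ≤ D₁ * (c ^ q)⁻¹ := by positivity
          linarith

theorem theorem1 (K : Set ℂ) (hK : IsConvexPolygonalDomain K) :
    ∃ n₀ : ℕ, ∀ q : ℝ, 0 < q →
      ∃ c : ℝ, 0 < c ∧ ∀ n : ℕ, n₀ ≤ n → ∀ p ∈ polynomialsWithZerosIn n K,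
        ENNReal.ofReal (c * n) * boundaryLqNorm K q p
          ≤ boundaryLqNorm K q (Polynomial.derivative p) := by
  -- The degree bound `N`, which depends on q, has been absorbed into the constant, so the threshold
  -- is 1 for every q.
  refine ⟨1, fun q hq => ?_⟩
  obtain ⟨D, hD, H⟩ := exists_pow_norm_le hK hq
  refine ⟨(D ^ (1 / q))⁻¹, by positivity, fun n hn p hp => ?_⟩
  have h := ENNReal.rpow_le_rpow (H n hn p hp) (one_div_pos.mpr hq).le
  rw [ENNReal.mul_rpow_of_nonneg _ _ (by positivity), ENNReal.mul_rpow_of_nonneg _ _ (by positivity),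
    ENNReal.ofReal_rpow_of_nonneg (by positivity) (by positivity),
    ENNReal.ofReal_rpow_of_nonneg hD.le (by positivity), ← Real.rpow_mul n.cast_nonneg,
    mul_one_div_cancel hq.ne', Real.rpow_one] at h
  unfold boundaryLqNorm
  rw [ENNReal.ofReal_mul (by positivity), mul_assoc]
  refine (mul_le_mul_right h _).trans_eq ?_
  rw [← mul_assoc, ← ENNReal.ofReal_mul (by positivity), inv_mul_cancel₀ (by positivity),
    ENNReal.ofReal_one, one_mul]
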